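/- **Setting.** Let $\Omega\subset\mathbb R^3$ be a bounded domain with smooth boundary and outward unit normal $\boldsymbol n$, let $c_{\mathrm{ex}},\alpha>0$, and write $\Omega_T=\Omega\times(0,T)$, $\langle\cdot,\cdot\rangle_\Omega$, $\|\cdot\|_\Omega$ for the inner product and norm of $L^2(\Omega)$. Let $\boldsymbol\pi:H^1(\Omega,\mathbb S^2)\to L^2(\Omega,\mathbb R^3)$ be a (nonlinear) operator such that (a) $\boldsymbol\pi$ maps $C^\infty(\overline\Omega,\mathbb S^2)$ into $C^\infty(\overline\Omega,\mathbb R^3)$; (b) for every $\boldsymbol u\in C^\infty(\overline\Omega,\mathbb S^2)$ there is a constant $c_{\boldsymbol\pi}$ with $\|\boldsymbol\pi[\boldsymbol u]-\boldsymbol\pi[\boldsymbol w]\|_{L^2(\Omega)}^2\le c_{\boldsymbol\pi}^2\|\boldsymbol u-\boldsymbol w\|_{H^1(\Omega)}^2$ for all $\boldsymbol w\in H^1(\Omega,\mathbb S^2)$. Put $\mathcal K[\boldsymbol m]:=c_{\mathrm{ex}}\Delta\boldsymbol m+\boldsymbol\pi[\boldsymbol m]-\alpha\,\partial_t\boldsymbol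 m$ and consider the generalized LLG equation $\partial_t\boldsymbol m=-\boldsymbol m\times\mathcal K[\boldsymbol m]$ with $\partial_{\boldsymbol n}\boldsymbol m=0$ on $\partial\Omega$ and initial value $\boldsymbol m^*\in H^1(\Omega,\mathbb S^2)$. For a time-dependent field let $$\mathcal E[\boldsymbol m](T):=\frac{c_{\mathrm{ex}}}{2}\|\nabla\boldsymbol m(T)\|_\Omega^2+\int_0^T\alpha\|\partial_t\boldsymbol m\|_\Omega^2 .$$ A field $\boldsymbol m\in L^\infty(\mathbb R_+,H^1(\Omega,\mathbb S^2))$, with $t\mapsto\boldsymbol\pi[\boldsymbol m(t)]\in L^2(\Omega)$ measurable, is a *global weak solution* if (i) for every $T>0$, $\boldsymbol m\in H^1(\Omega_T,\mathbb S^2)$, and $\boldsymbol m(0)=\boldsymbol m^*$ in the sense of traces; (ii) for every $T>0$ and every $\boldsymbol\varphi\in H^1(\Omega_T,\mathbb R^3)$, $$\int_0^T\langle\partial_t\boldsymbol m,\boldsymbol\varphi\rangle_\Omega=\int_0^T\Big(\alpha\langle\partial_t\boldsymbol m,\boldsymbol\varphi\times\boldsymbol m\rangle_\Omega+c_{\mathrm{ex}}\langle\nabla\boldsymbol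 m,\nabla(\boldsymbol\varphi\times\boldsymbol m)\rangle_\Omega\Big)-\int_0^T\langle\boldsymbol\pi[\boldsymbol m],\boldsymbol\varphi\times\boldsymbol m\rangle_\Omega ;$$ (iii) for a.e. $T>0$, $\ \mathcal E[\boldsymbol m](T)\le\frac{c_{\mathrm{ex}}}{2}\|\nabla\boldsymbol m^*\|_\Omega^2+\int_0^T\langle\partial_t\boldsymbol m,\boldsymbol\pi[\boldsymbol m]\rangle_\Omega$. **Lemma 4.2.** Let $\boldsymbol m_2$ be a global weak solution. Let $T^*>0$ and let $\boldsymbol m_1\in C^\infty(\overline\Omega\times[0,T^*],\mathbb S^2)$ be a strong solution on $\overline\Omega\times[0,T^*]$ with the same initial value, that is, $\partial_t\boldsymbol m_1=-\boldsymbol m_1\times\mathcal K[\boldsymbol m_1]$ pointwise, $\partial_{\boldsymbol n}\boldsymbol m_1=0$ on $\partial\Omega\times[0,T^*]$ and $\boldsymbol m_1(0)=\boldsymbol m^*$, where $\mathcal K[\boldsymbol m_1]$ and its spatial gradient are continuous on $\overline\Omega\times[0,T^*]$. Set $\boldsymbol v:=\boldsymbol m_2-\boldsymbol m_1$ and $\boldsymbol\pi_{\boldsymbol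 m_1}[\boldsymbol v]:=\boldsymbol\pi[\boldsymbol m_1+\boldsymbol v]-\boldsymbol\pi[\boldsymbol m_1]$. Then for a.e. $T\in[0,T^*)$ $$\mathcal E[\boldsymbol v](T)\le-c_{\mathrm{ex}}\int_0^T\langle\boldsymbol v\times\nabla\mathcal K[\boldsymbol m_1],\nabla\boldsymbol v\rangle_\Omega+\int_0^T\langle\boldsymbol\pi_{\boldsymbol m_1}[\boldsymbol v]-\alpha\,\partial_t\boldsymbol v,\ \boldsymbol v\times\mathcal K[\boldsymbol m_1]\rangle_\Omega+\int_0^T\langle\partial_t\boldsymbol v,\boldsymbol\pi_{\boldsymbol m_1}[\boldsymbol v]\rangle_\Omega ,$$ where $\boldsymbol v\times\nabla\mathcal K[\boldsymbol m_1]:=(\boldsymbol v\times\partial_i\mathcal K[\boldsymbol m_1])_{i=1,2,3}$. -/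

import Mathlib

open MeasureTheory Filter Topology Set
open scoped ContDiff InnerProductSpace

noncomputable section

namespace LLG

/-- Euclidean three-space; it is both the space containing the body and the space of values. -/
abbrev R3 : Type := EuclideanSpace ℝ (Fin 3)

/-- The `i`-th vector of the canonical basis. -/
def e (i : Fin 3) : R3 := EuclideanSpace.single i (1 : ℝ)

/-- The cross product on Euclidean three-space. -/
def cross (a b : R3) : R3 := WithLp.toLp 2 (crossProduct a.ofLp b.ofLp)

/-- The `L²(Ω)` inner product of two vector fields. -/
def ip (Ω : Set R3) (f g : R3 → R3) : ℝ := ∫ x in Ω, inner ℝ (f x) (g x)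

/-- The squared `L²(Ω)` norm of a vector field. -/
def normSq (Ω : Set R3) (f : R3 → R3) : ℝ := ∫ x in Ω, ‖f x‖ ^ 2

/-! ### Domains with smooth boundary -/

/-- `ρ` is a smooth defining function of `Ω`: `Ω = {ρ < 0}` and the gradient of `ρ` does not vanish
on `{ρ = 0}`, which is then the boundary of `Ω`. A bounded open set has a smooth boundary
if and only if it has such a defining function. -/
structure IsDefiningFunction (Ω : Set R3) (ρ : R3 → ℝ) : Prop where
  smooth : ContDiff ℝ ∞ ρ
  eq_sublevel : Ω = {x | ρ x < 0}
  gradient_ne_zero : ∀ x, ρ x = 0 → gradient ρ x ≠ 0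

/-- The outward unit normal at boundary points of the domain with defining function `ρ`. -/
def normal (ρ : R3 → ℝ) (x : R3) : R3 := ‖gradient ρ x‖⁻¹ • gradient ρ x

/-! ### Sobolev spaces -/

/-- On the open set `U`, the function `g` is the weak directional derivative of `u` in the
direction `d`. It is only used for functions which are square integrable on `U`. -/
def IsWeakDeriv {X : Type*} [NormedAddCommGroup X] [NormedSpace ℝ X] [MeasureSpace X]
    (U : Set X) (d : X) (u g : X → R3) : Prop :=
  ∀ φ : X → ℝ, ContDiff ℝ ∞ φ → HasCompactSupport φ → tsupport φ ⊆ U →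
    ∫ x in U, (fderiv ℝ φ x d) • u x = - ∫ x in U, φ x • g x

/-- `u ∈ H¹(Ω, ℝ³)`, with weak partial derivatives `∂ᵢ u = G i`. -/
structure IsH1 (Ω : Set R3) (u : R3 → R3) (G : Fin 3 → R3 → R3) : Prop where
  memLp : MemLp u 2 (volume.restrict Ω)
  grad_memLp : ∀ i, MemLp (G i) 2 (volume.restrict Ω)
  grad_weak : ∀ i, IsWeakDeriv Ω (e i) u (G i)

/-- `u ∈ H¹(Ω, 𝕊²)`, with weak partial derivatives `∂ᵢ u = G i`. -/
structure IsH1Sphere (Ω : Set R3) (u : R3 → R3) (G : Fin 3 → R3 → R3) : Prop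
    extends IsH1 Ω u G where
  sphere : ∀ᵐ x ∂(volume.restrict Ω), ‖u x‖ = 1

/-- The space-time cylinder `Ω_T = Ω × (0, T)`. -/
def cyl (Ω : Set R3) (T : ℝ) : Set (R3 × ℝ) := Ω ×ˢ Ioo 0 T

/-- `u ∈ H¹(Ω_T, ℝ³)`, with weak spatial partial derivatives `∂ᵢ u = G i` and weak time
derivative `∂ₜ u = D`. -/
structure IsH1Cyl (Ω : Set R3) (T : ℝ) (u : R3 × ℝ → R3) (G : Fin 3 → R3 × ℝ → R3)
    (D : R3 × ℝ → R3) : Prop where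
  memLp : MemLp u 2 (volume.restrict (cyl Ω T))
  grad_memLp : ∀ i, MemLp (G i) 2 (volume.restrict (cyl Ω T))
  grad_weak : ∀ i, IsWeakDeriv (cyl Ω T) ((e i, 0) : R3 × ℝ) u (G i)
  dt_memLp : MemLp D 2 (volume.restrict (cyl Ω T))
  dt_weak : IsWeakDeriv (cyl Ω T) ((0, 1) : R3 × ℝ) u D

/-! ### Classical fields -/

/-- `u ∈ C^∞(Ω̄, 𝕊²)`. A smooth field on `Ω̄` is given as the restriction of a smooth field
on the whole space. -/
structure IsSmoothSphere (Ω : Set R3) (u : R3 → R3) : Prop where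
  smooth : ContDiff ℝ ∞ u
  sphere : ∀ x ∈ closure Ω, ‖u x‖ = 1

/-- The classical spatial partial derivative `∂ᵢ f`. -/
def dx (i : Fin 3) (f : R3 × ℝ → R3) (p : R3 × ℝ) : R3 :=
  fderiv ℝ (fun y => f (y, p.2)) p.1 (e i)

/-- The classical time derivative `∂ₜ f`. -/
def dt (f : R3 × ℝ → R3) (p : R3 × ℝ) : R3 := deriv (fun s => f (p.1, s)) p.2

/-- The time slice `f(t) = f(·, t)`. -/
def slice (f : R3 × ℝ → R3) (t : ℝ) : R3 → R3 := fun x => f (x, t)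

/-- `P ∈ C([0, T]; C¹(Ω̄))`: on `Ω̄ × [0, T]` the field `P` is continuous, and its classical
spatial derivatives in `Ω × [0, T]` extend continuously to `Ω̄ × [0, T]`. -/
structure IsContC1 (Ω : Set R3) (T : ℝ) (P : R3 × ℝ → R3) : Prop where
  cont : ContinuousOn P (closure Ω ×ˢ Icc 0 T)
  diff : ∀ t ∈ Icc 0 T, DifferentiableOn ℝ (slice P t) Ω
  grad_cont : ∀ i, ∃ Q : R3 × ℝ → R3, ContinuousOn Q (closure Ω ×ˢ Icc 0 T) ∧
    ∀ x ∈ Ω, ∀ t ∈ Icc 0 T, Q (x, t) = dx i P (x, t)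

/-! ### The lower-order operator `π` -/

/-- `π : H¹(Ω, 𝕊²) → L²(Ω, ℝ³)` is a (nonlinear) operator which maps `C^∞(Ω̄, 𝕊²)` into
`C^∞(Ω̄, ℝ³)` and satisfies
`‖π[u] - π[w]‖²_{L²(Ω)} ≤ c_π² ‖u - w‖²_{H¹(Ω)}` for `u ∈ C^∞(Ω̄, 𝕊²)`, `w ∈ H¹(Ω, 𝕊²)`, with a
constant that may depend on `u` but not on `w`.

Fields are represented by functions on `ℝ³`; `congr` says that `π` acts on classes of fields
modulo equality a.e. in `Ω`. Nothing is assumed on `π u` for `u` outside `H¹(Ω, 𝕊²)`. -/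
structure IsAdmissible (Ω : Set R3) (π : (R3 → R3) → (R3 → R3)) : Prop where
  congr : ∀ u w G, IsH1Sphere Ω u G → u =ᵐ[volume.restrict Ω] w →
    π u =ᵐ[volume.restrict Ω] π w
  memLp : ∀ u G, IsH1Sphere Ω u G → MemLp (π u) 2 (volume.restrict Ω)
  smooth : ∀ u, IsSmoothSphere Ω u →
    ∃ w : R3 → R3, ContDiff ℝ ∞ w ∧ π u =ᵐ[volume.restrict Ω] w
  lipschitz : ∀ u, IsSmoothSphere Ω u → ∃ cπ : ℝ, ∀ w G, IsH1Sphere Ω w G →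
    normSq Ω (fun x => π u x - π w x) ≤
      cπ ^ 2 * (normSq Ω (fun x => u x - w x) +
        ∑ i, normSq Ω (fun x => fderiv ℝ u x (e i) - G i x))

/-- `π_u[v] = π[u + v] - π[u]`. -/
def piShift (π : (R3 → R3) → (R3 → R3)) (u v : R3 → R3) : R3 → R3 :=
  fun x => π (fun y => u y + v y) x - π u x

/-! ### Energy, weak solutions and strong solutions -/

/-- The energy `(c/2) ‖∇m(T)‖²_Ω + ∫₀ᵀ α ‖∂ₜ m‖²_Ω` of a field `m` with spatial derivatives
`∂ᵢ m = G i` and time derivative `∂ₜ m = D`. -/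
def energy (Ω : Set R3) (c α : ℝ) (G : Fin 3 → R3 × ℝ → R3) (D : R3 × ℝ → R3) (T : ℝ) : ℝ :=
  c / 2 * (∑ i, normSq Ω (slice (G i) T)) + ∫ t in (0 : ℝ)..T, α * normSq Ω (slice D t)

/-- `m ∈ L^∞(ℝ₊, H¹(Ω, 𝕊²))`, with weak derivatives `∂ᵢ m = G i` and `∂ₜ m = D`, is a global weak
solution of `∂ₜ m = - m × (c Δm + π[m] - α ∂ₜ m)`, `∂ₙ m = 0`, with initial value `m*`, whose
weak partial derivatives are `∂ᵢ m* = Gs i`.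

* In `weak_form`, `∇(φ × m)` is expanded by the product rule
  `∂ᵢ(φ × m) = ∂ᵢφ × m + φ × ∂ᵢm`.
* `pi_meas` says that `t ↦ π[m(t)]` is measurable with values in `L²(Ω)`, so that the integrals in
  time make sense.
* `initial` says that `m(t) → m*` in `L²(Ω)` as `t → 0⁺`, for `t` outside a null set. -/
structure IsWeakSolution (Ω : Set R3) (c α : ℝ) (π : (R3 → R3) → (R3 → R3))
    (ms : R3 → R3) (Gs : Fin 3 → R3 → R3)
    (m : R3 × ℝ → R3) (G : Fin 3 → R3 × ℝ → R3) (D : R3 × ℝ → R3) : Prop where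
  slice_h1 : ∀ᵐ t ∂(volume.restrict (Ioi (0 : ℝ))),
    IsH1Sphere Ω (slice m t) (fun i => slice (G i) t)
  bounded : ∃ C : ℝ, ∀ᵐ t ∂(volume.restrict (Ioi (0 : ℝ))),
    normSq Ω (slice m t) + ∑ i, normSq Ω (slice (G i) t) ≤ C
  h1_cyl : ∀ T > 0, IsH1Cyl Ω T m G D
  initial : Tendsto (fun t => normSq Ω (fun x => m (x, t) - ms x))
    (𝓝[>] (0 : ℝ) ⊓ ae volume) (𝓝 0)
  pi_meas : ∃ P : R3 × ℝ → R3, AEStronglyMeasurable P (volume.restrict (Ω ×ˢ Ioi (0 : ℝ))) ∧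
    ∀ᵐ t ∂(volume.restrict (Ioi (0 : ℝ))), π (slice m t) =ᵐ[volume.restrict Ω] slice P t
  weak_form : ∀ T > 0, ∀ φ Gφ Dφ, IsH1Cyl Ω T φ Gφ Dφ →
    (∫ t in (0 : ℝ)..T, ip Ω (slice D t) (slice φ t)) =
      (∫ t in (0 : ℝ)..T,
        (α * ip Ω (slice D t) (fun x => cross (φ (x, t)) (m (x, t))) +
          c * ∑ i, ip Ω (slice (G i) t)
            (fun x => cross (Gφ i (x, t)) (m (x, t)) + cross (φ (x, t)) (G i (x, t))))) -
      ∫ t in (0 : ℝ)..T, ip Ω (π (slice m t)) (fun x => cross (φ (x, t)) (m (x, t)))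
  energy_ineq : ∀ᵐ T ∂(volume.restrict (Ioi (0 : ℝ))),
    energy Ω c α G D T ≤ c / 2 * (∑ i, normSq Ω (Gs i)) +
      ∫ t in (0 : ℝ)..T, ip Ω (slice D t) (π (slice m t))

/-- `K[m] = c Δm + π[m] - α ∂ₜ m` for a smooth field `m`, where `P` is the field
`(x, t) ↦ π[m(t)](x)`. -/
def effField (c α : ℝ) (m P : R3 × ℝ → R3) (p : R3 × ℝ) : R3 :=
  c • Laplacian.laplacian (fun y => m (y, p.2)) p.1 + P p - α • dt m p

/-- `m ∈ C^∞(Ω̄ × [0, T*], 𝕊²)` is a strong solution of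
`∂ₜ m = - m × (c Δm + π[m] - α ∂ₜ m)` on `Ω̄ × [0, T*]`, with `∂ₙ m = 0` on `∂Ω` and
`m(0) = m*`. The domain `Ω` has the defining function `ρ`, and `P` is the representative of
`(x, t) ↦ π[m(t)](x)` which is in `C([0, T*]; C¹(Ω̄))`. A smooth field on `Ω̄ × [0, T*]` is given
as the restriction of a smooth field on `ℝ³ × ℝ`. -/
structure IsStrongSolution (Ω : Set R3) (ρ : R3 → ℝ) (c α : ℝ) (π : (R3 → R3) → (R3 → R3))
    (ms : R3 → R3) (Ts : ℝ) (m P : R3 × ℝ → R3) : Prop where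
  smooth : ContDiff ℝ ∞ m
  sphere : ∀ x ∈ closure Ω, ∀ t ∈ Icc 0 Ts, ‖m (x, t)‖ = 1
  pi_rep : ∀ t ∈ Icc 0 Ts, π (slice m t) =ᵐ[volume.restrict Ω] slice P t
  pi_reg : IsContC1 Ω Ts P
  equation : ∀ x ∈ Ω, ∀ t ∈ Ioo 0 Ts,
    dt m (x, t) = - cross (m (x, t)) (effField c α m P (x, t))
  neumann : ∀ x ∈ frontier Ω, ∀ t ∈ Icc 0 Ts, fderiv ℝ (slice m t) x (normal ρ x) = 0
  initial : slice m 0 =ᵐ[volume.restrict Ω] ms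

end LLG

end

/-! This is a relative energy estimate: the energy of `v` is expanded about the smooth solution, the
energy inequality of `m₂` is inserted, and all that remains is an identity. Since ‖∇v‖² = ‖∇m₂‖² -
‖∇m₁‖² - 2⟨∇m₁, ∇v⟩, and ‖∂ₜv‖² expands likewise, the energy of `m₂` enters with a positive sign;
this is the only inequality used. The growth of ‖∇m₁‖² is classical (`normSq_slice_eq`). The product
⟨∇m₁, ∇v⟩ at time T is the integral over (0, T) of ⟨∇∂ₜm₁, ∇v⟩ - ⟨Δm₁, ∂ₜv⟩, because m₁ and ∂ₜm₁
both satisfy the Neumann condition and v(0) = 0 (`ae_integral_inner_grad_eq`).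

It remains to compare integrands at almost every time. Write K = K[m₁], so that ∂ₜm₁ = K × m₁. The
two sides then differ by the weak equation of m₂ tested with K, plus c times the divergence of the
products of ∂ᵢm₁ × K with v. The latter integrates to zero because ∂ₙm₁ × K = 0 on the boundary. The
pointwise computation consists of two polynomial identities, `gradient_identity` and
`energy_identity`, assembled in `integral_slice_identity`.

Two points need care. Nothing is known about ∂ₜπ[m₁], so K is not available as a test field on the
space-time cylinder. The weak formulation is therefore localised in time for a fixed smooth field
(`ae_integral_weak_form`), used for K(q) at all rational times q, and carried over to K(t) by
continuity (`ae_integral_eq_zero_of_forall_smooth`). Secondly, boundary terms are treated without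
traces: fields are cut off by a function of nρ, and a normal component that vanishes on the boundary
is O(|ρ|), which compensates the factor n from the derivative of the cut-off
(`integral_divergence_eq_zero`). -/

noncomputable section

namespace LLG

/-! ### The cross product -/

lemma cross_zero_apply (a b : R3) : cross a b 0 = a 1 * b 2 - a 2 * b 1 := by
  simp [cross, crossProduct]

lemma cross_one_apply (a b : R3) : cross a b 1 = a 2 * b 0 - a 0 * b 2 := by
  simp [cross, crossProduct]

lemma cross_two_apply (a b : R3) : cross a b 2 = a 0 * b 1 - a 1 * b 0 := by
  simp [cross, crossProduct]

lemma inner_eq_coord (a b : R3) : inner ℝ a b = a 0 * b 0 + a 1 * b 1 + a 2 * b 2 := by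
  simp [PiLp.inner_apply, Fin.sum_univ_three, mul_comm]

lemma norm_sq_eq_coord (a : R3) : ‖a‖ ^ 2 = a 0 * a 0 + a 1 * a 1 + a 2 * a 2 := by
  rw [← real_inner_self_eq_norm_sq, inner_eq_coord]

lemma ext_coord {a b : R3} (h0 : a 0 = b 0) (h1 : a 1 = b 1) (h2 : a 2 = b 2) : a = b := by
  ext i; fin_cases i <;> assumption

lemma norm_cross_le (a b : R3) : ‖cross a b‖ ≤ ‖a‖ * ‖b‖ := by
  refine le_of_sq_le_sq ?_ (by positivity)
  rw [mul_pow, norm_sq_eq_coord, norm_sq_eq_coord, norm_sq_eq_coord, cross_zero_apply,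
    cross_one_apply, cross_two_apply]
  nlinarith [sq_nonneg (a 0 * b 0 + a 1 * b 1 + a 2 * b 2)]

/-- The cross product as a continuous bilinear map. -/
def crossL : R3 →L[ℝ] R3 →L[ℝ] R3 :=
  LinearMap.mkContinuous₂
    (LinearMap.mk₂ ℝ cross
      (fun a a' b => by
        apply ext_coord <;>
          simp only [cross_zero_apply, cross_one_apply, cross_two_apply, PiLp.add_apply] <;> ring)
      (fun k a b => by
        apply ext_coord <;>
          simp only [cross_zero_apply, cross_one_apply, cross_two_apply, PiLp.smul_apply,
            smul_eq_mul] <;> ring)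
      (fun a b b' => by
        apply ext_coord <;>
          simp only [cross_zero_apply, cross_one_apply, cross_two_apply, PiLp.add_apply] <;> ring)
      (fun k a b => by
        apply ext_coord <;>
          simp only [cross_zero_apply, cross_one_apply, cross_two_apply, PiLp.smul_apply,
            smul_eq_mul] <;> ring))
    1 (fun a b => by simpa using norm_cross_le a b)

lemma crossL_apply (a b : R3) : crossL a b = cross a b := rfl

lemma inner_cross_self_right (a b : R3) : inner ℝ b (cross a b) = 0 := by
  rw [inner_eq_coord, cross_zero_apply, cross_one_apply, cross_two_apply]; ring

lemma continuous_cross : Continuous fun p : R3 × R3 => cross p.1 p.2 := by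
  simp only [← crossL_apply]; fun_prop

lemma contDiff_cross {X : Type*} [NormedAddCommGroup X] [NormedSpace ℝ X] {n : WithTop ℕ∞}
    {f g : X → R3} (hf : ContDiff ℝ n f) (hg : ContDiff ℝ n g) :
    ContDiff ℝ n fun x => cross (f x) (g x) := by
  simp only [← crossL_apply]
  exact (crossL.contDiff.comp hf).clm_apply hg

lemma fderiv_cross {X : Type*} [NormedAddCommGroup X] [NormedSpace ℝ X] {f g : X → R3} {x : X}
    (hf : DifferentiableAt ℝ f x) (hg : DifferentiableAt ℝ g x) (d : X) :
    fderiv ℝ (fun y => cross (f y) (g y)) x d =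
      cross (fderiv ℝ f x d) (g x) + cross (f x) (fderiv ℝ g x d) := by
  have h := (crossL.hasFDerivAt_of_bilinear hf.hasFDerivAt hg.hasFDerivAt).fderiv
  simp only [crossL_apply] at h
  rw [h]
  simp [crossL_apply, add_comm]

/-! ### Classical derivatives of smooth fields -/

lemma dx_eq {f : R3 × ℝ → R3} {p : R3 × ℝ} (hf : DifferentiableAt ℝ f p) (i : Fin 3) :
    dx i f p = fderiv ℝ f p (e i, 0) := by
  have h : HasFDerivAt (fun y : R3 => (y, p.2))
      ((ContinuousLinearMap.id ℝ R3).prod (0 : R3 →L[ℝ] ℝ)) p.1 :=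
    (hasFDerivAt_id p.1).prodMk (hasFDerivAt_const p.2 p.1)
  have h2 := (HasFDerivAt.comp p.1 (g := f) hf.hasFDerivAt h).fderiv
  have h3 : dx i f p = fderiv ℝ (f ∘ fun y : R3 => (y, p.2)) p.1 (e i) := rfl
  rw [h3, h2]; simp

lemma dt_eq {f : R3 × ℝ → R3} {p : R3 × ℝ} (hf : DifferentiableAt ℝ f p) :
    dt f p = fderiv ℝ f p (0, 1) := by
  have h : HasDerivAt (fun s : ℝ => (p.1, s)) ((0 : R3), (1 : ℝ)) p.2 :=
    (hasDerivAt_const p.2 p.1).prodMk (hasDerivAt_id p.2)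
  exact (HasFDerivAt.comp_hasDerivAt p.2 (l := f) hf.hasFDerivAt h).deriv

lemma contDiff_dx {f : R3 × ℝ → R3} (hf : ContDiff ℝ ∞ f) (i : Fin 3) :
    ContDiff ℝ ∞ (dx i f) := by
  have : dx i f = fun p => fderiv ℝ f p (e i, 0) :=
    funext fun p => dx_eq (hf.differentiable (by simp) p) i
  rw [this]
  exact (hf.fderiv_right (m := ∞) (by simp)).clm_apply contDiff_const

lemma contDiff_dt {f : R3 × ℝ → R3} (hf : ContDiff ℝ ∞ f) : ContDiff ℝ ∞ (dt f) := by
  have : dt f = fun p => fderiv ℝ f p (0, 1) :=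
    funext fun p => dt_eq (hf.differentiable (by simp) p)
  rw [this]
  exact (hf.fderiv_right (m := ∞) (by simp)).clm_apply contDiff_const

lemma hasDerivAt_dt {f : R3 × ℝ → R3} (hf : ContDiff ℝ ∞ f) (x : R3) (t : ℝ) :
    HasDerivAt (fun s => f (x, s)) (dt f (x, t)) t := by
  have : DifferentiableAt ℝ (fun s => f (x, s)) t := by
    have := hf.differentiable (by simp)
    fun_prop
  exact this.hasDerivAt

lemma contDiff_slice {f : R3 × ℝ → R3} (hf : ContDiff ℝ ∞ f) (t : ℝ) :
    ContDiff ℝ ∞ (slice f t) :=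
  hf.comp (contDiff_id.prodMk contDiff_const)

lemma fderiv_slice (f : R3 × ℝ → R3) (t : ℝ) (x : R3) (i : Fin 3) :
    fderiv ℝ (slice f t) x (e i) = dx i f (x, t) := rfl

lemma fderiv_fderiv_apply {X Y : Type*} [NormedAddCommGroup X] [NormedSpace ℝ X]
    [NormedAddCommGroup Y] [NormedSpace ℝ Y] {f : X → Y} (hf : ContDiff ℝ ∞ f) (p a b : X) :
    fderiv ℝ (fun q => fderiv ℝ f q a) p b = fderiv ℝ (fderiv ℝ f) p b a := by
  have h : DifferentiableAt ℝ (fderiv ℝ f) p :=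
    (hf.fderiv_right (m := ∞) (by simp)).differentiable (by simp) p
  rw [fderiv_clm_apply h (differentiableAt_const a)]
  simp

lemma dx_dt_comm {f : R3 × ℝ → R3} (hf : ContDiff ℝ ∞ f) (i : Fin 3) (p : R3 × ℝ) :
    dx i (dt f) p = dt (dx i f) p := by
  have hd : Differentiable ℝ f := hf.differentiable (by simp)
  rw [dx_eq ((contDiff_dt hf).differentiable (by simp) p),
    dt_eq ((contDiff_dx hf i).differentiable (by simp) p),
    show dt f = fun p => fderiv ℝ f p (0, 1) from funext fun p => dt_eq (hd p),
    show dx i f = fun p => fderiv ℝ f p (e i, 0) from funext fun p => dx_eq (hd p) i,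
    fderiv_fderiv_apply hf, fderiv_fderiv_apply hf]
  exact (hf.contDiffAt.isSymmSndFDerivAt (by simp; exact WithTop.coe_le_coe.2 (le_top : (2 : ℕ∞) ≤ ⊤))) _ _

/-- The spatial Laplacian, as the sum of the second partial derivatives. -/
def lap (f : R3 × ℝ → R3) (p : R3 × ℝ) : R3 := ∑ i, dx i (dx i f) p

lemma contDiff_lap {f : R3 × ℝ → R3} (hf : ContDiff ℝ ∞ f) : ContDiff ℝ ∞ (lap f) :=
  ContDiff.sum fun i _ => contDiff_dx (contDiff_dx hf i) i

lemma laplacian_eq_lap {f : R3 × ℝ → R3} (hf : ContDiff ℝ ∞ f) (p : R3 × ℝ) :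
    Laplacian.laplacian (fun y => f (y, p.2)) p.1 = lap f p := by
  rw [InnerProductSpace.laplacian_eq_iteratedFDeriv_orthonormalBasis _
    (EuclideanSpace.basisFun (Fin 3) ℝ)]
  refine Finset.sum_congr rfl fun i _ => ?_
  rw [iteratedFDeriv_two_apply]
  have := fderiv_fderiv_apply (contDiff_slice hf p.2) p.1 (e i) (e i)
  simp only [EuclideanSpace.basisFun_apply]
  exact this.symm

lemma dt_finset_sum {ι : Type*} (s : Finset ι) {F : ι → R3 × ℝ → R3}
    (hF : ∀ j ∈ s, ContDiff ℝ ∞ (F j)) (p : R3 × ℝ) :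
    dt (fun q => ∑ j ∈ s, F j q) p = ∑ j ∈ s, dt (F j) p := by
  simp only [dt]
  exact deriv_fun_sum fun j hj => (hasDerivAt_dt (hF j hj) p.1 p.2).differentiableAt

lemma dt_lap {f : R3 × ℝ → R3} (hf : ContDiff ℝ ∞ f) (p : R3 × ℝ) :
    dt (lap f) p = ∑ i, dx i (dx i (dt f)) p := by
  rw [show lap f = fun q => ∑ i, dx i (dx i f) q from rfl,
    dt_finset_sum _ fun j _ => contDiff_dx (contDiff_dx hf j) j]
  refine Finset.sum_congr rfl fun i _ => ?_
  rw [← dx_dt_comm (contDiff_dx hf i), show dx i (dt f) = dt (dx i f) from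
    funext fun q => dx_dt_comm hf i q]

/-! ### Weak derivatives of classical fields -/

/-- Continuity has to be checked only on `tsupport φ`, which lies in the open set where `u` is
continuous; the values of `u` outside `U` play no role. -/
lemma continuous_smul_of_tsupport_subset {X : Type*} [TopologicalSpace X] {U : Set X}
    (hU : IsOpen U) {φ : X → ℝ} {u : X → R3} (hφ : Continuous φ) (hs : tsupport φ ⊆ U)
    (hu : ContinuousOn u U) : Continuous fun x => φ x • u x := by
  refine continuous_of_tsupport fun x hx => ?_
  have hxU : x ∈ U := hs (closure_mono (Function.support_smul_subset_left φ u) hx)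
  exact hφ.continuousAt.smul (hu.continuousAt (hU.mem_nhds hxU))

/-- Both integrands vanish off `U`, so the integrals extend to the whole space, where integration by
parts needs the derivative of `u` only on the support of `φ`. -/
lemma isWeakDeriv_of_hasLineDerivAt {X : Type*} [NormedAddCommGroup X] [NormedSpace ℝ X]
    [MeasureSpace X] [BorelSpace X] [FiniteDimensional ℝ X]
    [(volume : Measure X).IsAddHaarMeasure]
    {U : Set X} (hU : IsOpen U) {d : X} {u g : X → R3}
    (hu : ContinuousOn u U) (hg : ContinuousOn g U)
    (hd : ∀ x ∈ U, HasLineDerivAt ℝ u (g x) x d) : IsWeakDeriv U d u g := by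
  intro φ hφ hc hs
  have h0 : ∀ x, x ∉ U → φ x = 0 := fun x hx =>
    image_eq_zero_of_notMem_tsupport fun h => hx (hs h)
  have hφ' : Continuous fun x => fderiv ℝ φ x d :=
    (hφ.continuous_fderiv (by simp)).clm_apply continuous_const
  have hs' : tsupport (fun x => fderiv ℝ φ x d) ⊆ tsupport φ := tsupport_fderiv_apply_subset ℝ d
  have hc' : HasCompactSupport (fun x => fderiv ℝ φ x d) := hc.fderiv_apply ℝ d
  have h1 : ∀ x, x ∉ U → fderiv ℝ φ x d = 0 := fun x hx =>
    image_eq_zero_of_notMem_tsupport (f := fun x => fderiv ℝ φ x d) fun h => hx (hs (hs' h))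
  rw [setIntegral_eq_integral_of_forall_compl_eq_zero fun x hx => by simp [h1 x hx],
    setIntegral_eq_integral_of_forall_compl_eq_zero fun x hx => by simp [h0 x hx]]
  have key := integral_bilinear_hasLineDerivAt_right_eq_neg_left_of_integrable
    (μ := (volume : Measure X)) (B := ContinuousLinearMap.lsmul ℝ ℝ) (f := φ)
    (f' := fun x => fderiv ℝ φ x d) (g := u) (g' := g) (v := d)
    ((continuous_smul_of_tsupport_subset hU hφ' (hs'.trans hs) hu).integrable_of_hasCompactSupport
      hc'.smul_right)
    ((continuous_smul_of_tsupport_subset hU hφ.continuous hs hg).integrable_of_hasCompactSupport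
      hc.smul_right)
    ((continuous_smul_of_tsupport_subset hU hφ.continuous hs hu).integrable_of_hasCompactSupport
      hc.smul_right)
    (fun x _ => ((hφ.differentiable (by simp) x).hasFDerivAt).hasLineDerivAt d)
    (fun x hx => hd x (hs hx))
  simp only [ContinuousLinearMap.lsmul_apply] at key
  rw [key, neg_neg]

lemma isWeakDeriv_of_contDiff {X : Type*} [NormedAddCommGroup X] [NormedSpace ℝ X]
    [MeasureSpace X] [BorelSpace X] [FiniteDimensional ℝ X]
    [(volume : Measure X).IsAddHaarMeasure]
    {U : Set X} (hU : IsOpen U) (d : X) {u : X → R3} (hu : ContDiff ℝ ∞ u) :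
    IsWeakDeriv U d u (fun x => fderiv ℝ u x d) :=
  isWeakDeriv_of_hasLineDerivAt hU hu.continuous.continuousOn
    ((hu.continuous_fderiv (by simp)).clm_apply continuous_const).continuousOn
    fun x _ => ((hu.differentiable (by simp) x).hasFDerivAt).hasLineDerivAt d

lemma integrable_smul_of_hasCompactSupport {X : Type*} [TopologicalSpace X] [MeasurableSpace X]
    [OpensMeasurableSpace X] {μ : Measure X} {φ : X → ℝ} (hφ : Continuous φ)
    (hc : HasCompactSupport φ) {u : X → R3} (hu : Integrable u μ) :
    Integrable (fun x => φ x • u x) μ := by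
  obtain ⟨C, hC⟩ := hc.exists_bound_of_continuous hφ
  exact hu.bdd_smul C hφ.aestronglyMeasurable (ae_of_all _ hC)

lemma IsWeakDeriv.sub {X : Type*} [NormedAddCommGroup X] [NormedSpace ℝ X]
    [MeasureSpace X] [BorelSpace X] {U : Set X} {d : X} {u u' g g' : X → R3}
    (h : IsWeakDeriv U d u g) (h' : IsWeakDeriv U d u' g')
    (hu : IntegrableOn u U) (hu' : IntegrableOn u' U) (hg : IntegrableOn g U)
    (hg' : IntegrableOn g' U) :
    IsWeakDeriv U d (fun x => u x - u' x) (fun x => g x - g' x) := by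
  intro φ hφ hc hs
  have hφ' : Continuous fun x => fderiv ℝ φ x d :=
    (hφ.continuous_fderiv (by simp)).clm_apply continuous_const
  have hc' : HasCompactSupport (fun x => fderiv ℝ φ x d) := hc.fderiv_apply ℝ d
  simp only [smul_sub]
  rw [integral_sub (integrable_smul_of_hasCompactSupport hφ' hc' hu)
      (integrable_smul_of_hasCompactSupport hφ' hc' hu'),
    integral_sub (integrable_smul_of_hasCompactSupport hφ.continuous hc hg)
      (integrable_smul_of_hasCompactSupport hφ.continuous hc hg'),
    h φ hφ hc hs, h' φ hφ hc hs]
  abel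

/-- The fundamental lemma of the calculus of variations applies to `g - g'`. This serves to identify
the given gradient of the initial value with the classical gradient of m₁(0). -/
lemma IsWeakDeriv.ae_eq {X : Type*} [NormedAddCommGroup X] [NormedSpace ℝ X]
    [FiniteDimensional ℝ X] [MeasureSpace X] [BorelSpace X] {U : Set X} (hU : IsOpen U) {d : X}
    {u u' g g' : X → R3} (h : IsWeakDeriv U d u g) (h' : IsWeakDeriv U d u' g')
    (huu : u =ᵐ[volume.restrict U] u') (hg : IntegrableOn g U) (hg' : IntegrableOn g' U) :
    g =ᵐ[volume.restrict U] g' := by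
  have key := hU.ae_eq_zero_of_integral_contDiff_smul_eq_zero (μ := (volume : Measure X))
    (f := fun x => g x - g' x) (hg.sub hg').locallyIntegrableOn (fun φ hφ hc hs => by
      rw [← setIntegral_eq_integral_of_forall_compl_eq_zero (s := U) fun x hx => by
        simp [image_eq_zero_of_notMem_tsupport fun h => hx (hs h)]]
      simp only [smul_sub]
      rw [integral_sub (integrable_smul_of_hasCompactSupport hφ.continuous hc hg)
        (integrable_smul_of_hasCompactSupport hφ.continuous hc hg')]
      have h1 := h φ hφ hc hs
      have h2 := h' φ hφ hc hs
      rw [integral_congr_ae (g := fun x => (fderiv ℝ φ x d) • u' x)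
        (huu.mono fun x hx => by simp only [hx]), h2] at h1
      rw [neg_injective h1, sub_self])
  filter_upwards [ae_restrict_of_ae key, ae_restrict_mem hU.measurableSet] with x hx hxU
  exact sub_eq_zero.1 (hx hxU)

/-! ### Vector-valued test functions -/

/-- The `k`-th coordinate as a continuous linear form. -/
def coordL (k : Fin 3) : R3 →L[ℝ] ℝ := EuclideanSpace.proj k

/-- Each coordinate of `Φ` is a scalar test function; the k-th one is used, the k-th coordinate of
the resulting vector identity is kept, and these are summed. -/
lemma IsWeakDeriv.integral_inner {X : Type*} [NormedAddCommGroup X] [NormedSpace ℝ X]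
    [MeasureSpace X] [BorelSpace X] {U : Set X} {d : X} {u g : X → R3}
    (h : IsWeakDeriv U d u g) (hu : IntegrableOn u U) (hg : IntegrableOn g U)
    {Φ : X → R3} (hΦ : ContDiff ℝ ∞ Φ) (hc : HasCompactSupport Φ) (hs : tsupport Φ ⊆ U) :
    ∫ x in U, (inner ℝ (fderiv ℝ Φ x d) (u x) : ℝ) = - ∫ x in U, (inner ℝ (Φ x) (g x) : ℝ) := by
  have hcoord : ∀ k : Fin 3, ContDiff ℝ ∞ fun x => Φ x k := fun k => by fun_prop
  have hck : ∀ k : Fin 3, HasCompactSupport fun x => Φ x k := fun k =>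
    hc.comp_left (g := fun a : R3 => a k) (by simp)
  have hsk : ∀ k : Fin 3, tsupport (fun x => Φ x k) ⊆ U := fun k =>
    (closure_mono (Function.support_comp_subset (g := fun a : R3 => a k) (by simp) Φ)).trans hs
  have hfd : ∀ (k : Fin 3) x, fderiv ℝ (fun x => Φ x k) x d = fderiv ℝ Φ x d k := fun k x => by
    have := ((coordL k).hasFDerivAt.comp x
      (hΦ.differentiable (by simp) x).hasFDerivAt).fderiv
    rw [show (fun x => Φ x k) = coordL k ∘ Φ from rfl, this]; rfl
  have hφ' : ∀ k : Fin 3, Continuous fun x => fderiv ℝ (fun x => Φ x k) x d := fun k =>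
    ((hcoord k).continuous_fderiv (by simp)).clm_apply continuous_const
  have key : ∀ (a : X → R3) (w : X → R3),
      (∀ k : Fin 3, Integrable (fun x => a x k • w x) (volume.restrict U)) →
      ∫ x in U, (inner ℝ (a x) (w x) : ℝ) = ∑ k : Fin 3, (∫ x in U, a x k • w x) k := by
    intro a w haw
    have h1 : ∀ k : Fin 3, (∫ x in U, a x k • w x) k = ∫ x in U, coordL k (a x k • w x) := fun k =>
      ((coordL k).integral_comp_comm (haw k)).symm
    simp only [h1]
    rw [← integral_finsetSum _ fun k _ =>
      (coordL k).integrable_comp (haw k)]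
    refine integral_congr_ae (ae_of_all _ fun x => ?_)
    simp only [inner_eq_coord, Fin.sum_univ_three]; rfl
  rw [key _ _ fun k => ?_, key _ _ fun k => ?_, ← Finset.sum_neg_distrib]
  · refine Finset.sum_congr rfl fun k _ => ?_
    have := h _ (hcoord k) (hck k) (hsk k)
    simp only [hfd] at this
    rw [this]; rfl
  · exact integrable_smul_of_hasCompactSupport (hcoord k).continuous (hck k) hg
  · simp only [← hfd]
    exact integrable_smul_of_hasCompactSupport (hφ' k) ((hck k).fderiv_apply ℝ d) hu

/-! ### Cut-off functions -/

/-- A smooth function on the line which is `1` on `(-∞, -2]` and `0` on `[-1, ∞)`. -/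
def step (s : ℝ) : ℝ := Real.smoothTransition (-s - 1)

lemma contDiff_step {n : ℕ∞} : ContDiff ℝ n step :=
  Real.smoothTransition.contDiff.comp (by fun_prop)

lemma step_eq_one {s : ℝ} (h : s ≤ -2) : step s = 1 :=
  Real.smoothTransition.one_of_one_le (by linarith)

lemma step_eq_zero {s : ℝ} (h : -1 ≤ s) : step s = 0 :=
  Real.smoothTransition.zero_of_nonpos (by linarith)

lemma abs_step_le_one (s : ℝ) : |step s| ≤ 1 :=
  abs_le.2 ⟨le_trans (by norm_num) (Real.smoothTransition.nonneg (-s - 1)),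
    Real.smoothTransition.le_one _⟩

lemma deriv_step_eq_zero {s : ℝ} (h : s < -2 ∨ -1 < s) : deriv step s = 0 := by
  rcases h with h | h
  · have : step =ᶠ[𝓝 s] fun _ => (1 : ℝ) := by
      filter_upwards [Iio_mem_nhds h] with y hy using step_eq_one (le_of_lt hy)
    rw [this.deriv_eq]; simp
  · have : step =ᶠ[𝓝 s] fun _ => (0 : ℝ) := by
      filter_upwards [Ioi_mem_nhds h] with y hy using step_eq_zero (le_of_lt hy)
    rw [this.deriv_eq]; simp

/-- The derivative of `step` lives on [-2, -1]. With s = nρ this bounds n |`step`'(nρ)| by M / |ρ|,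
uniformly in n. -/
lemma exists_mul_deriv_step_le : ∃ M : ℝ, ∀ s, |s * deriv step s| ≤ M := by
  have hc : HasCompactSupport fun s => s * deriv step s :=
    HasCompactSupport.intro isCompact_Icc fun s hs => by
      rw [deriv_step_eq_zero (s := s) (by
        simp only [mem_Icc, not_and_or, not_le] at hs; exact hs), mul_zero]
  exact hc.exists_bound_of_continuous (continuous_id.mul
    ((contDiff_step (n := 1)).continuous_deriv (by simp)))

/-- A cut-off function which vanishes near the boundary of `{ρ < 0}`, if `0 < n`. -/
def cutoff (ρ : R3 → ℝ) (n : ℝ) (x : R3) : ℝ := step (n * ρ x)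

lemma contDiff_cutoff {ρ : R3 → ℝ} (hρ : ContDiff ℝ ∞ ρ) (n : ℝ) :
    ContDiff ℝ ∞ (cutoff ρ n) :=
  contDiff_step.comp (contDiff_const.mul hρ)

lemma tsupport_cutoff_subset {ρ : R3 → ℝ} (hρ : Continuous ρ) (n : ℝ) :
    tsupport (cutoff ρ n) ⊆ {x | n * ρ x ≤ -1} := by
  refine closure_minimal (fun x hx => ?_) (isClosed_le (by fun_prop) continuous_const)
  by_contra h
  exact hx (step_eq_zero (le_of_not_ge h))

lemma tsupport_cutoff_subset_of_pos {Ω : Set R3} {ρ : R3 → ℝ} (hρ : IsDefiningFunction Ω ρ)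
    {n : ℝ} (hn : 0 < n) : tsupport (cutoff ρ n) ⊆ Ω := by
  intro x hx
  have h := tsupport_cutoff_subset hρ.smooth.continuous n hx
  rw [hρ.eq_sublevel]
  simp only [mem_ofPred_eq] at h ⊢
  by_contra h'
  nlinarith [mul_nonneg hn.le (not_lt.1 h')]

lemma hasCompactSupport_cutoff {Ω : Set R3} (hb : Bornology.IsBounded Ω) {ρ : R3 → ℝ}
    (hρ : IsDefiningFunction Ω ρ) {n : ℝ} (hn : 0 < n) : HasCompactSupport (cutoff ρ n) :=
  Metric.isCompact_of_isClosed_isBounded (isClosed_tsupport _)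
    (hb.subset (tsupport_cutoff_subset_of_pos hρ hn))

lemma abs_cutoff_le_one (ρ : R3 → ℝ) (n : ℝ) (x : R3) : |cutoff ρ n x| ≤ 1 :=
  abs_step_le_one _

lemma fderiv_cutoff {ρ : R3 → ℝ} (hρ : ContDiff ℝ ∞ ρ) (n : ℝ) (x d : R3) :
    fderiv ℝ (cutoff ρ n) x d = deriv step (n * ρ x) * n * fderiv ℝ ρ x d := by
  have h1 : HasDerivAt step (deriv step (n * ρ x)) (n * ρ x) :=
    ((contDiff_step (n := 1)).differentiable (by simp) _).hasDerivAt
  have h2 : HasFDerivAt (fun y => n * ρ y) (n • fderiv ℝ ρ x) x :=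
    (hρ.differentiable (by simp) x).hasFDerivAt.const_mul n
  have := (h1.comp_hasFDerivAt x h2).fderiv
  rw [show cutoff ρ n = step ∘ fun y => n * ρ y from rfl, this]
  simp [mul_assoc]

lemma eventually_mul_le {a : ℝ} (ha : a < 0) : ∀ᶠ n : ℕ in atTop, ((n : ℝ) + 1) * a < -2 := by
  have : Tendsto (fun n : ℕ => ((n : ℝ) + 1) * a) atTop atBot :=
    (tendsto_natCast_atTop_atTop.atTop_add tendsto_const_nhds).atTop_mul_const_of_neg ha
  exact this.eventually_lt_atBot (-2)

lemma eventually_cutoff_eq_one {ρ : R3 → ℝ} {x : R3} (hx : ρ x < 0) :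
    ∀ᶠ n : ℕ in atTop, cutoff ρ ((n : ℝ) + 1) x = 1 := by
  filter_upwards [eventually_mul_le hx] with n hn using step_eq_one hn.le

/-! ### Functions which vanish on the boundary -/

lemma IsDefiningFunction.isOpen {Ω : Set R3} {ρ : R3 → ℝ} (hρ : IsDefiningFunction Ω ρ) :
    IsOpen Ω := by
  rw [hρ.eq_sublevel]; exact isOpen_lt hρ.smooth.continuous continuous_const

/-- A zero of `ρ` away from the closure of `Ω` would be a local minimum of `ρ`, where the gradient
vanishes. -/
lemma IsDefiningFunction.mem_frontier {Ω : Set R3} {ρ : R3 → ℝ} (hρ : IsDefiningFunction Ω ρ)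
    {x : R3} (hx : ρ x = 0) : x ∈ frontier Ω := by
  rw [hρ.isOpen.frontier_eq]
  refine ⟨?_, by rw [hρ.eq_sublevel]; simp [hx]⟩
  by_contra h
  have hmin : IsLocalMin ρ x := by
    filter_upwards [isClosed_closure.isOpen_compl.mem_nhds h] with y hy
    rw [hx]
    by_contra hlt
    exact hy (subset_closure (by rw [hρ.eq_sublevel]; exact not_le.1 hlt))
  exact hρ.gradient_ne_zero x hx (by simp [gradient, hmin.fderiv_eq_zero])

lemma IsDefiningFunction.nonpos_of_mem_closure {Ω : Set R3} {ρ : R3 → ℝ}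
    (hρ : IsDefiningFunction Ω ρ) {x : R3} (hx : x ∈ closure Ω) : ρ x ≤ 0 :=
  closure_minimal (t := {x | ρ x ≤ 0}) (fun y hy => by
    rw [hρ.eq_sublevel] at hy; exact le_of_lt (show ρ y < 0 from hy))
    (isClosed_le hρ.smooth.continuous continuous_const) hx

/-- From x one moves in the fixed direction d = ∇ρ(p). Near p the function `ρ` grows in this
direction at rate at least ‖d‖² / 2, so a boundary point is met at a parameter of at most 2|ρ(x)| /
‖d‖². There `f` vanishes, and the local Lipschitz bound of `f` gives the estimate. -/
lemma exists_local_bound_of_eq_zero {Ω : Set R3} {ρ : R3 → ℝ} (hρ : IsDefiningFunction Ω ρ)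
    {f : R3 → R3} (hf : ContDiff ℝ ∞ f) (h0 : ∀ x ∈ frontier Ω, f x = 0) {p : R3}
    (hp : ρ p = 0) : ∃ V ∈ 𝓝 p, ∃ C : ℝ, ∀ x ∈ V ∩ Ω, ‖f x‖ ≤ C * |ρ x| := by
  set d := gradient ρ p with hd
  have hd0 : 0 < ‖d‖ := norm_pos_iff.2 (hρ.gradient_ne_zero p hp)
  set a := ‖d‖ ^ 2 with ha
  have ha0 : 0 < a := by positivity
  have hdp : fderiv ℝ ρ p d = a := by
    rw [ha, ← real_inner_self_eq_norm_sq, hd, gradient, InnerProductSpace.toDual_symm_apply]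
  obtain ⟨K, W, hW, hK⟩ := (hf.of_le (m := 1) (by simp)).contDiffAt.exists_lipschitzOnWith
    (x := p)
  have hcont : Continuous fun y => fderiv ℝ ρ y d :=
    (hρ.smooth.continuous_fderiv (by simp)).clm_apply continuous_const
  have hev : ∀ᶠ y in 𝓝 p, a / 2 < fderiv ℝ ρ y d :=
    continuousAt_const.eventually_lt hcont.continuousAt (by rw [hdp]; linarith)
  obtain ⟨r, hr, hball⟩ := Metric.mem_nhds_iff.1 (inter_mem hW hev)
  have hsmall : ∀ᶠ y in 𝓝 p, 2 * |ρ y| / a * ‖d‖ < r / 2 := by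
    have : ContinuousAt (fun y => 2 * |ρ y| / a * ‖d‖) p := by
      have := hρ.smooth.continuous
      fun_prop
    exact this.eventually_lt continuousAt_const (by simp [hp, hr])
  -- Starting in the half ball and travelling less than r / 2 keeps the segment in the ball of
  -- radius r, where the Lipschitz and growth bounds both hold.
  refine ⟨_, inter_mem (Metric.ball_mem_nhds p (half_pos hr)) hsmall, K * (2 * ‖d‖ / a), ?_⟩
  rintro x ⟨⟨hxb, hxs⟩, hxΩ⟩
  have hρx : ρ x < 0 := by rw [hρ.eq_sublevel] at hxΩ; exact hxΩ
  set s₀ := 2 * |ρ x| / a with hs₀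
  have hs₀' : 0 ≤ s₀ := by positivity
  have hseg : ∀ s ∈ Icc 0 s₀, x + s • d ∈ Metric.ball p r := by
    intro s hs
    have h1 : ‖s • d‖ ≤ s₀ * ‖d‖ := by
      rw [norm_smul, Real.norm_of_nonneg hs.1]
      exact mul_le_mul_of_nonneg_right hs.2 hd0.le
    rw [Metric.mem_ball, dist_eq_norm] at hxb ⊢
    calc ‖x + s • d - p‖ = ‖(x - p) + s • d‖ := by congr 1; abel
      _ ≤ ‖x - p‖ + ‖s • d‖ := norm_add_le _ _
      _ < r := by
        have : s₀ * ‖d‖ < r / 2 := hxs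
        linarith
  have hder : ∀ s : ℝ, HasDerivAt (fun s : ℝ => ρ (x + s • d)) (fderiv ℝ ρ (x + s • d) d) s := by
    intro s
    have h1 : HasDerivAt (fun s : ℝ => x + s • d) d s := by
      simpa using ((hasDerivAt_id s).smul_const d).const_add x
    exact (hρ.smooth.differentiable (by simp) _).hasFDerivAt.comp_hasDerivAt s h1
  have hgrow : a / 2 * (s₀ - 0) ≤ ρ (x + s₀ • d) - ρ (x + (0 : ℝ) • d) := by
    refine (convex_Icc (0 : ℝ) s₀).mul_sub_le_image_sub_of_le_deriv
      (f := fun s : ℝ => ρ (x + s • d))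
      (fun s _ => (hder s).continuousAt.continuousWithinAt)
      (fun s _ => (hder s).differentiableAt.differentiableWithinAt) (fun s hs => ?_)
      0 ⟨le_rfl, hs₀'⟩ s₀ ⟨hs₀', le_rfl⟩ hs₀'
    rw [(hder s).deriv]
    exact le_of_lt (hball (hseg s (interior_subset hs))).2
  have hend : 0 ≤ ρ (x + s₀ • d) := by
    have h2 : a / 2 * (s₀ - 0) = |ρ x| := by rw [hs₀]; field_simp; simp
    rw [h2, abs_of_neg hρx] at hgrow
    simp only [zero_smul, add_zero] at hgrow
    linarith
  obtain ⟨s, hs, hs0⟩ := intermediate_value_Icc hs₀'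
    (f := fun s : ℝ => ρ (x + s • d)) (fun s _ => (hder s).continuousAt.continuousWithinAt)
    (show (0 : ℝ) ∈ Icc (ρ (x + (0 : ℝ) • d)) (ρ (x + s₀ • d)) from
      ⟨by simpa using hρx.le, hend⟩)
  have hfz : f (x + s • d) = 0 := h0 _ (hρ.mem_frontier hs0)
  have hxW : x ∈ W := by
    have := hball (hseg 0 ⟨le_rfl, hs₀'⟩)
    simpa using this.1
  have := hK.norm_sub_le hxW (hball (hseg s hs)).1
  rw [hfz, sub_zero] at this
  refine this.trans ?_
  have h3 : ‖x - (x + s • d)‖ ≤ s₀ * ‖d‖ := by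
    rw [sub_add_cancel_left, norm_neg, norm_smul, Real.norm_of_nonneg hs.1]
    exact mul_le_mul_of_nonneg_right hs.2 hd0.le
  calc (K : ℝ) * ‖x - (x + s • d)‖ ≤ K * (s₀ * ‖d‖) := by gcongr
    _ = K * (2 * ‖d‖ / a) * |ρ x| := by rw [hs₀]; ring

/-- Local constants are patched by compactness of the closure: inside `Ω` the quantity |ρ| is
locally bounded below and boundedness of `f` suffices, while at the boundary the previous lemma
applies. -/
lemma exists_bound_of_eq_zero_on_frontier {Ω : Set R3} (hb : Bornology.IsBounded Ω) {ρ : R3 → ℝ}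
    (hρ : IsDefiningFunction Ω ρ) {f : R3 → R3} (hf : ContDiff ℝ ∞ f)
    (h0 : ∀ x ∈ frontier Ω, f x = 0) : ∃ C : ℝ, ∀ x ∈ Ω, ‖f x‖ ≤ C * |ρ x| := by
  have hcpt : IsCompact (closure Ω) := hb.isCompact_closure
  have key : ∃ C : ℝ, ∀ x ∈ closure Ω ∩ Ω, ‖f x‖ ≤ C * |ρ x| := by
    refine hcpt.induction_on (p := fun s => ∃ C : ℝ, ∀ x ∈ s ∩ Ω, ‖f x‖ ≤ C * |ρ x|)
      ⟨0, by simp⟩ ?_ ?_ ?_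
    · rintro s t hst ⟨C, hC⟩
      exact ⟨C, fun x hx => hC x ⟨hst hx.1, hx.2⟩⟩
    · rintro s t ⟨C, hC⟩ ⟨C', hC'⟩
      refine ⟨max C C', ?_⟩
      rintro x ⟨hx | hx, hxΩ⟩
      · exact (hC x ⟨hx, hxΩ⟩).trans
          (mul_le_mul_of_nonneg_right (le_max_left _ _) (abs_nonneg _))
      · exact (hC' x ⟨hx, hxΩ⟩).trans
          (mul_le_mul_of_nonneg_right (le_max_right _ _) (abs_nonneg _))
    · intro p hp
      rcases (hρ.nonpos_of_mem_closure hp).lt_or_eq with hlt | heq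
      · have h1 : ∀ᶠ y in 𝓝 p, ‖f y‖ < ‖f p‖ + 1 :=
          hf.continuous.norm.continuousAt.eventually_lt continuousAt_const (by simp)
        have h2 : ∀ᶠ y in 𝓝 p, ρ y < ρ p / 2 :=
          hρ.smooth.continuous.continuousAt.eventually_lt continuousAt_const (by linarith)
        refine ⟨_, mem_nhdsWithin_of_mem_nhds (inter_mem h1 h2), (‖f p‖ + 1) / (|ρ p| / 2), ?_⟩
        rintro x ⟨⟨hx1, hx2⟩, -⟩
        simp only [mem_ofPred_eq] at hx1 hx2
        have h3 : |ρ p| / 2 ≤ |ρ x| := by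
          rw [abs_of_neg hlt, abs_of_neg (by linarith)]; linarith
        have h4 : 0 < |ρ p| / 2 := by have := abs_pos.2 hlt.ne; linarith
        calc ‖f x‖ ≤ (‖f p‖ + 1) / (|ρ p| / 2) * (|ρ p| / 2) := by
              rw [div_mul_cancel₀ _ h4.ne']; exact hx1.le
          _ ≤ _ := by gcongr
      · obtain ⟨V, hV, C, hC⟩ := exists_local_bound_of_eq_zero hρ hf h0 heq
        exact ⟨V, mem_nhdsWithin_of_mem_nhds hV, C, hC⟩
  obtain ⟨C, hC⟩ := key
  exact ⟨C, fun x hx => hC x ⟨subset_closure hx, hx⟩⟩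

/-! ### Integrability on bounded domains and the divergence theorem -/

lemma exists_bound_on_of_continuous {Ω : Set R3} (hb : Bornology.IsBounded Ω) {Y : Type*}
    [NormedAddCommGroup Y] {f : R3 → Y} (hf : Continuous f) : ∃ C, ∀ x ∈ Ω, ‖f x‖ ≤ C := by
  obtain ⟨C, hC⟩ := hb.isCompact_closure.exists_bound_of_continuousOn hf.continuousOn
  exact ⟨C, fun x hx => hC x (subset_closure hx)⟩

lemma isFiniteMeasure_restrict {Ω : Set R3} (hb : Bornology.IsBounded Ω) :
    IsFiniteMeasure (volume.restrict Ω) :=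
  ⟨by rw [Measure.restrict_apply_univ]; exact hb.measure_lt_top⟩

lemma IsH1.integrableOn {Ω : Set R3} (hb : Bornology.IsBounded Ω) {u : R3 → R3}
    {G : Fin 3 → R3 → R3} (hu : IsH1 Ω u G) : IntegrableOn u Ω :=
  haveI := isFiniteMeasure_restrict hb
  hu.memLp.integrable (by norm_num)

lemma IsH1.integrableOn_grad {Ω : Set R3} (hb : Bornology.IsBounded Ω) {u : R3 → R3}
    {G : Fin 3 → R3 → R3} (hu : IsH1 Ω u G) (i : Fin 3) : IntegrableOn (G i) Ω :=
  haveI := isFiniteMeasure_restrict hb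
  (hu.grad_memLp i).integrable (by norm_num)

lemma integrable_inner_of_bound {X : Type*} [MeasurableSpace X] {μ : Measure X} {f g : X → R3}
    (hf : AEStronglyMeasurable f μ) {C : ℝ} (hC : ∀ᵐ x ∂μ, ‖f x‖ ≤ C) (hg : Integrable g μ) :
    Integrable (fun x => (inner ℝ (f x) (g x) : ℝ)) μ := by
  refine (hg.norm.const_mul C).mono' (hf.inner hg.1) ?_
  filter_upwards [hC] with x hx
  exact (norm_inner_le_norm _ _).trans (mul_le_mul_of_nonneg_right hx (norm_nonneg _))

/-- The divergence theorem for the product of an `H¹` field and a smooth matrix field whose normal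
component vanishes on the boundary. -/
lemma integral_divergence_eq_zero {Ω : Set R3} (hb : Bornology.IsBounded Ω) {ρ : R3 → ℝ}
    (hρ : IsDefiningFunction Ω ρ) {u : R3 → R3} {G : Fin 3 → R3 → R3} (hu : IsH1 Ω u G)
    {X : Fin 3 → R3 → R3} (hX : ∀ i, ContDiff ℝ ∞ (X i))
    (h0 : ∀ x ∈ frontier Ω, ∑ i, fderiv ℝ ρ x (e i) • X i x = 0) :
    ∫ x in Ω, ∑ i, ((inner ℝ (X i x) (G i x) : ℝ) + inner ℝ (fderiv ℝ (X i) x (e i)) (u x)) = 0 := by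
  have hρd : ∀ i, ContDiff ℝ ∞ fun x => fderiv ℝ ρ x (e i) := fun i =>
    (hρ.smooth.fderiv_right (m := ∞) (by simp)).clm_apply contDiff_const
  have hXd : ∀ i, Continuous fun x => fderiv ℝ (X i) x (e i) := fun i =>
    ((hX i).continuous_fderiv (by simp)).clm_apply continuous_const
  set N : R3 → R3 := fun x => ∑ i, fderiv ℝ ρ x (e i) • X i x with hN
  have hNs : ContDiff ℝ ∞ N := ContDiff.sum fun i _ => (hρd i).smul (hX i)
  obtain ⟨C, hC⟩ := exists_bound_of_eq_zero_on_frontier hb hρ hNs h0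
  obtain ⟨M, hM⟩ := exists_mul_deriv_step_le
  have hui := hu.integrableOn hb
  have hGi := hu.integrableOn_grad hb
  set F : R3 → ℝ := fun x =>
    ∑ i, ((inner ℝ (X i x) (G i x) : ℝ) + inner ℝ (fderiv ℝ (X i) x (e i)) (u x)) with hF
  have hint : ∀ {A w : R3 → R3}, Continuous A → IntegrableOn w Ω →
      IntegrableOn (fun x => (inner ℝ (A x) (w x) : ℝ)) Ω := by
    intro A w hA hw
    obtain ⟨B, hB⟩ := exists_bound_on_of_continuous hb hA
    exact integrable_inner_of_bound hA.aestronglyMeasurable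
      ((ae_restrict_mem hρ.isOpen.measurableSet).mono fun x hx => hB x hx) hw
  have hFi : IntegrableOn F Ω := integrable_finsetSum _ fun i _ =>
    (hint (hX i).continuous (hGi i)).add (hint (hXd i) hui)
  -- This is the divergence integrand of the compactly supported field `cutoff ρ n • X`; the second
  -- summand arises where the derivative falls on the cut-off.
  set E : ℝ → R3 → ℝ := fun n x =>
    cutoff ρ n x * F x + deriv step (n * ρ x) * n * inner ℝ (N x) (u x) with hE
  have hEzero : ∀ n : ℝ, 0 < n → ∫ x in Ω, E n x = 0 := by
    intro n hn
    have hcut := contDiff_cutoff hρ.smooth n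
    have hΦ : ∀ i, ContDiff ℝ ∞ fun x => cutoff ρ n x • X i x := fun i => hcut.smul (hX i)
    have hcs : ∀ i, HasCompactSupport fun x => cutoff ρ n x • X i x := fun i =>
      (hasCompactSupport_cutoff hb hρ hn).smul_right
    have hts : ∀ i, tsupport (fun x => cutoff ρ n x • X i x) ⊆ Ω := fun i =>
      (closure_mono (Function.support_smul_subset_left _ _)).trans
        (tsupport_cutoff_subset_of_pos hρ hn)
    have hparts := fun i => (hu.grad_weak i).integral_inner hui (hGi i) (hΦ i) (hcs i) (hts i)
    have hEeq : ∀ x, E n x = ∑ i, ((inner ℝ (fderiv ℝ (fun x => cutoff ρ n x • X i x) x (e i))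
        (u x) : ℝ) + inner ℝ (cutoff ρ n x • X i x) (G i x)) := by
      intro x
      have hfd : ∀ i, fderiv ℝ (fun x => cutoff ρ n x • X i x) x (e i) =
          cutoff ρ n x • fderiv ℝ (X i) x (e i) +
            (deriv step (n * ρ x) * n * fderiv ℝ ρ x (e i)) • X i x := fun i => by
        rw [fderiv_fun_smul (hcut.differentiable (by simp) x) ((hX i).differentiable (by simp) x)]
        simp [fderiv_cutoff hρ.smooth]
      simp only [hE, hF, hN, hfd, Finset.mul_sum, sum_inner, inner_add_left, real_inner_smul_left,
        ← Finset.sum_add_distrib]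
      exact Finset.sum_congr rfl fun i _ => by ring
    simp only [hEeq]
    have hi1 : ∀ i, IntegrableOn (fun x => (inner ℝ
        (fderiv ℝ (fun x => cutoff ρ n x • X i x) x (e i)) (u x) : ℝ)) Ω := fun i =>
      hint (((hΦ i).continuous_fderiv (by simp)).clm_apply continuous_const) hui
    have hi2 : ∀ i, IntegrableOn (fun x => (inner ℝ (cutoff ρ n x • X i x) (G i x) : ℝ)) Ω :=
      fun i => hint (hΦ i).continuous (hGi i)
    rw [integral_finsetSum (s := Finset.univ) (f := fun i x => (inner ℝ
      (fderiv ℝ (fun x => cutoff ρ n x • X i x) x (e i)) (u x) : ℝ) +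
      inner ℝ (cutoff ρ n x • X i x) (G i x)) fun i _ => (hi1 i).add (hi2 i)]
    refine Finset.sum_eq_zero fun i _ => ?_
    rw [integral_add (hi1 i) (hi2 i), hparts i, neg_add_cancel]
  have hlim : Tendsto (fun n : ℕ => ∫ x in Ω, E ((n : ℝ) + 1) x) atTop (𝓝 (∫ x in Ω, F x)) := by
    -- The majorant does not depend on n: the derivative of the cut-off costs at most M / |ρ|, and
    -- |N| ≤ C|ρ| because the normal component vanishes on the boundary. At a fixed point of `Ω` the
    -- extra term is zero once the argument of `step` is below -2.
    refine tendsto_integral_of_dominated_convergence (fun x => ‖F x‖ + M * C * ‖u x‖) ?_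
      (hFi.norm.add (hui.norm.const_mul _)) ?_ ?_
    · intro n
      have h1 : Continuous (cutoff ρ ((n : ℝ) + 1)) := (contDiff_cutoff hρ.smooth _).continuous
      have h2 : Continuous fun x => deriv step (((n : ℝ) + 1) * ρ x) * ((n : ℝ) + 1) :=
        (((contDiff_step (n := 1)).continuous_deriv (by simp)).comp
          (continuous_const.mul hρ.smooth.continuous)).mul continuous_const
      exact (h1.aestronglyMeasurable.mul hFi.1).add
        (h2.aestronglyMeasurable.mul (hint hNs.continuous hui).1)
    · intro n
      filter_upwards [ae_restrict_mem hρ.isOpen.measurableSet] with x hx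
      have hn : (0 : ℝ) < (n : ℝ) + 1 := by positivity
      refine (norm_add_le _ _).trans (add_le_add ?_ ?_)
      · rw [norm_mul]
        exact mul_le_of_le_one_left (norm_nonneg _) (abs_cutoff_le_one _ _ _)
      · rw [norm_mul]
        have h1 : ‖(inner ℝ (N x) (u x) : ℝ)‖ ≤ C * |ρ x| * ‖u x‖ :=
          (norm_inner_le_norm _ _).trans (mul_le_mul_of_nonneg_right (hC x hx) (norm_nonneg _))
        have hC0 : 0 ≤ C * |ρ x| := (norm_nonneg _).trans (hC x hx)
        have hρx : ρ x < 0 := by rw [hρ.eq_sublevel] at hx; exact hx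
        have hC1 : 0 ≤ C := nonneg_of_mul_nonneg_left hC0 (abs_pos.2 hρx.ne)
        calc ‖deriv step (((n : ℝ) + 1) * ρ x) * ((n : ℝ) + 1)‖ * ‖(inner ℝ (N x) (u x) : ℝ)‖
            ≤ ‖deriv step (((n : ℝ) + 1) * ρ x) * ((n : ℝ) + 1)‖ * (C * |ρ x| * ‖u x‖) := by
              gcongr
          _ = |((n : ℝ) + 1) * ρ x * deriv step (((n : ℝ) + 1) * ρ x)| * (C * ‖u x‖) := by
              rw [Real.norm_eq_abs, abs_mul, abs_mul, abs_mul]; ring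
          _ ≤ M * (C * ‖u x‖) := by gcongr; exact hM _
          _ = M * C * ‖u x‖ := by ring
    · filter_upwards [ae_restrict_mem hρ.isOpen.measurableSet] with x hx
      have hρx : ρ x < 0 := by rw [hρ.eq_sublevel] at hx; exact hx
      refine tendsto_const_nhds.congr' ?_
      filter_upwards [eventually_mul_le hρx, eventually_cutoff_eq_one hρx] with n hn hn'
      simp only [hE]
      rw [hn', deriv_step_eq_zero (Or.inl hn)]
      ring
  refine tendsto_nhds_unique hlim ?_
  simp only [hEzero _ (by positivity : (0 : ℝ) < ((_ : ℕ) : ℝ) + 1)]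
  exact tendsto_const_nhds

/-! ### Weak derivatives on an interval -/

lemma exists_tsupport_subset_Icc {T : ℝ} (hT : 0 < T) {K : Set ℝ} (hK : IsCompact K)
    (hs : K ⊆ Ioo 0 T) : ∃ a b, 0 < a ∧ b < T ∧ a ≤ b ∧ K ⊆ Icc a b := by
  -- Adjoining `T / 2` covers empty `K`: the infimum and the supremum are then attained.
  have hK' : IsCompact (insert (T / 2) K) := hK.insert _
  have hs' : insert (T / 2) K ⊆ Ioo 0 T := insert_subset ⟨by linarith, by linarith⟩ hs
  have hne : (insert (T / 2) K).Nonempty := insert_nonempty _ _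
  have hsub : insert (T / 2) K ⊆ Icc (sInf (insert (T / 2) K)) (sSup (insert (T / 2) K)) :=
    fun x hx => ⟨csInf_le hK'.bddBelow hx, le_csSup hK'.bddAbove hx⟩
  refine ⟨_, _, (hs' (hK'.sInf_mem hne)).1, (hs' (hK'.sSup_mem hne)).2, ?_,
    (subset_insert _ _).trans hsub⟩
  exact (hsub (mem_insert _ _)).1.trans (hsub (mem_insert _ _)).2

/-- The primitive from 0 vanishes to the left of the support, and to the right of it because the
total integral is zero. -/
lemma exists_primitive {T : ℝ} (hT : 0 < T) {θ : ℝ → ℝ} (hθ : ContDiff ℝ ∞ θ)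
    (hc : HasCompactSupport θ) (hs : tsupport θ ⊆ Ioo 0 T) (h0 : ∫ t, θ t = 0) :
    ∃ Ψ : ℝ → ℝ, ContDiff ℝ ∞ Ψ ∧ HasCompactSupport Ψ ∧ tsupport Ψ ⊆ Ioo 0 T ∧ deriv Ψ = θ := by
  obtain ⟨a, b, ha, hb, hab, hsub⟩ := exists_tsupport_subset_Icc hT hc hs
  have hz : ∀ s, s ∉ Icc a b → θ s = 0 := fun s h =>
    image_eq_zero_of_notMem_tsupport fun h' => h (hsub h')
  have hder : ∀ t, HasDerivAt (fun t => ∫ s in (0 : ℝ)..t, θ s) (θ t) t := fun t =>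
    intervalIntegral.integral_hasDerivAt_right (hθ.continuous.intervalIntegrable _ _)
      (hθ.continuous.stronglyMeasurableAtFilter _ _) hθ.continuous.continuousAt
  have hd : deriv (fun t => ∫ s in (0 : ℝ)..t, θ s) = θ := funext fun t => (hder t).deriv
  have hΨ0 : ∀ t, t ∉ Icc a b → ∫ s in (0 : ℝ)..t, θ s = 0 := by
    intro t ht
    rw [mem_Icc, not_and_or, not_le, not_le] at ht
    rcases ht with ht | ht
    · refine intervalIntegral.integral_zero_ae (ae_of_all _ fun s hs => hz s fun h => ?_)
      have : s ≤ max 0 t := hs.2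
      exact absurd (h.1.trans this) (not_le.2 (max_lt ha ht))
    · rw [intervalIntegral.integral_eq_integral_of_support_subset, h0]
      intro s hs
      have := hsub (subset_tsupport _ hs)
      exact ⟨ha.trans_le this.1, this.2.trans ht.le⟩
  have hts : tsupport (fun t => ∫ s in (0 : ℝ)..t, θ s) ⊆ Icc a b :=
    closure_minimal (fun t ht => by_contra fun h => ht (hΨ0 t h)) isClosed_Icc
  refine ⟨_, ?_, HasCompactSupport.intro isCompact_Icc hΨ0, hts.trans ?_, hd⟩
  · rw [contDiff_infty_iff_deriv, hd]
    exact ⟨fun t => (hder t).differentiableAt, hθ⟩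
  · exact fun t ht => ⟨ha.trans_le ht.1, ht.2.trans_lt hb⟩

lemma setIntegral_smul_of_tsupport_subset {U : Set ℝ} {ψ h : ℝ → ℝ} (hs : tsupport ψ ⊆ U) :
    ∫ t in U, ψ t * h t = ∫ t, ψ t * h t :=
  setIntegral_eq_integral_of_forall_compl_eq_zero fun t ht => by
    simp [image_eq_zero_of_notMem_tsupport fun h' => ht (hs h')]

lemma integrableOn_mul_of_continuous {U : Set ℝ} {ψ h : ℝ → ℝ} (hψ : Continuous ψ)
    (hc : HasCompactSupport ψ) (hh : IntegrableOn h U) : IntegrableOn (fun t => ψ t * h t) U := by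
  obtain ⟨C, hC⟩ := hc.exists_bound_of_continuous hψ
  exact hh.bdd_mul hψ.aestronglyMeasurable (ae_of_all _ hC)

/-- This is the du Bois-Reymond argument. Subtracting (∫ψ)ψ₀ from ψ, with a fixed bump ψ₀ of
integral one, leaves a function of integral zero, hence the derivative of a test function. So `h -
c` is orthogonal to every ψ, where c = ∫ψ₀h. -/
lemma ae_eq_const_of_weak_deriv_eq_zero {T : ℝ} (hT : 0 < T) {h : ℝ → ℝ}
    (hh : IntegrableOn h (Ioo 0 T))
    (h0 : ∀ ψ : ℝ → ℝ, ContDiff ℝ ∞ ψ → HasCompactSupport ψ → tsupport ψ ⊆ Ioo 0 T →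
      ∫ t in Ioo 0 T, deriv ψ t * h t = 0) :
    ∃ c, ∀ᵐ t ∂(volume.restrict (Ioo 0 T)), h t = c := by
  let B : ContDiffBump (T / 2) := ⟨T / 8, T / 4, by linarith, by linarith⟩
  set ψ₀ := B.normed volume with hψ₀
  have hψ₀d : ContDiff ℝ ∞ ψ₀ := B.contDiff_normed
  have hψ₀c : HasCompactSupport ψ₀ := B.hasCompactSupport_normed
  have hψ₀s : tsupport ψ₀ ⊆ Ioo 0 T := by
    rw [B.tsupport_normed_eq]
    intro t ht
    rw [Metric.mem_closedBall, Real.dist_eq, abs_le] at ht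
    exact ⟨by linarith [ht.1, show B.rOut = T / 4 from rfl],
      by linarith [ht.2, show B.rOut = T / 4 from rfl]⟩
  have hψ₀i : ∫ t, ψ₀ t = 1 := B.integral_normed
  set c := ∫ t in Ioo 0 T, ψ₀ t * h t with hc
  have hconst : IntegrableOn (fun _ : ℝ => c) (Ioo 0 T) := integrableOn_const (by simp)
  refine ⟨c, ?_⟩
  have key := isOpen_Ioo.ae_eq_zero_of_integral_contDiff_smul_eq_zero (μ := (volume : Measure ℝ))
    (U := Ioo 0 T) (f := fun t => h t - c) (hh.sub hconst).locallyIntegrableOn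
    (fun ψ hψ hψc hψs => by
      have hint : ∀ {φ : ℝ → ℝ}, ContDiff ℝ ∞ φ → HasCompactSupport φ → Integrable φ :=
        fun hφ hφc => hφ.continuous.integrable_of_hasCompactSupport hφc
      obtain ⟨Ψ, hΨ, hΨc, hΨs, hΨd⟩ := exists_primitive hT
        (θ := fun t => ψ t - (∫ s, ψ s) * ψ₀ t)
        (hψ.sub (contDiff_const.mul hψ₀d)) (hψc.sub hψ₀c.mul_left)
        ((tsupport_sub ψ _).trans (union_subset hψs
          ((closure_mono (Function.support_mul_subset_right _ _)).trans hψ₀s)))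
        (by rw [integral_sub (hint hψ hψc) ((hint hψ₀d hψ₀c).const_mul _),
          integral_const_mul, hψ₀i, mul_one, sub_self])
      have h1 := h0 Ψ hΨ hΨc hΨs
      simp only [hΨd, sub_mul, mul_assoc] at h1
      rw [integral_sub (integrableOn_mul_of_continuous hψ.continuous hψc hh)
        ((integrableOn_mul_of_continuous hψ₀d.continuous hψ₀c hh).const_mul _),
        integral_const_mul, ← hc] at h1
      simp only [smul_eq_mul]
      rw [← setIntegral_smul_of_tsupport_subset (h := fun t => h t - c) hψs]
      simp only [mul_sub]
      rw [integral_sub (integrableOn_mul_of_continuous hψ.continuous hψc hh)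
        (integrableOn_mul_of_continuous hψ.continuous hψc hconst),
        setIntegral_smul_of_tsupport_subset (h := fun _ => c) hψs, integral_mul_const]
      linarith)
  filter_upwards [ae_restrict_of_ae key, ae_restrict_mem measurableSet_Ioo] with t ht htm
  exact sub_eq_zero.1 (ht htm)

/-- An integrable function with an integrable weak derivative is a primitive of it. -/
lemma ae_eq_const_add_integral_of_weak_deriv {T : ℝ} (hT : 0 < T) {f g : ℝ → ℝ}
    (hf : IntegrableOn f (Ioo 0 T)) (hg : IntegrableOn g (Ioo 0 T))
    (h : ∀ ψ : ℝ → ℝ, ContDiff ℝ ∞ ψ → HasCompactSupport ψ → tsupport ψ ⊆ Ioo 0 T →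
      ∫ t in Ioo 0 T, deriv ψ t * f t = - ∫ t in Ioo 0 T, ψ t * g t) :
    ∃ c, ∀ᵐ t ∂(volume.restrict (Ioo 0 T)), f t = c + ∫ s in (0 : ℝ)..t, g s := by
  have hgi : IntervalIntegrable g volume 0 T := by
    rw [intervalIntegrable_iff_integrableOn_Ioo_of_le hT.le]; exact hg
  set I : ℝ → ℝ := fun t => ∫ s in (0 : ℝ)..t, g s with hI
  have hIac : AbsolutelyContinuousOnInterval I 0 T :=
    hgi.absolutelyContinuousOnInterval_intervalIntegral (c := 0) (by simp)
  have hIi : IntegrableOn I (Ioo 0 T) := by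
    refine (ContinuousOn.integrableOn_Icc ?_).mono_set Ioo_subset_Icc_self
    simpa [uIcc_of_le hT.le] using hIac.continuousOn
  have hId : ∀ᵐ t, t ∈ Ioo 0 T → deriv I t = g t := by
    filter_upwards [hgi.ae_hasDerivAt_integral] with t ht htm
    exact (ht (by rw [uIcc_of_le hT.le]; exact Ioo_subset_Icc_self htm) 0 (by simp)).deriv
  -- The primitive of `g` is absolutely continuous, so it may be integrated by parts against ψ; its
  -- difference from `f` then has zero weak derivative.
  obtain ⟨c, hc⟩ := ae_eq_const_of_weak_deriv_eq_zero hT (h := fun t => f t - I t)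
    (hf.sub hIi) (fun ψ hψ hψc hψs => by
      have hψ' : Continuous (deriv ψ) := hψ.continuous_deriv (by simp)
      simp only [mul_sub]
      rw [integral_sub (integrableOn_mul_of_continuous hψ' hψc.deriv hf)
        (integrableOn_mul_of_continuous hψ' hψc.deriv hIi), h ψ hψ hψc hψs]
      obtain ⟨C, hC⟩ := ContDiff.lipschitzWith_of_hasCompactSupport hψc hψ (by simp)
      have hψac : AbsolutelyContinuousOnInterval ψ 0 T :=
        (hC.lipschitzOnWith (s := uIcc 0 T)).absolutelyContinuousOnInterval
      have h1 := hψac.integral_mul_deriv_eq_deriv_mul hIac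
      have hz : ∀ t, t ∉ Ioo 0 T → ψ t = 0 := fun t ht =>
        image_eq_zero_of_notMem_tsupport fun h' => ht (hψs h')
      rw [hz 0 (by simp), hz T (by simp), intervalIntegral.integral_of_le hT.le,
        intervalIntegral.integral_of_le hT.le, integral_Ioc_eq_integral_Ioo,
        integral_Ioc_eq_integral_Ioo] at h1
      have h2 : ∫ t in Ioo 0 T, ψ t * deriv I t = ∫ t in Ioo 0 T, ψ t * g t :=
        setIntegral_congr_ae measurableSet_Ioo (hId.mono fun t ht htm => by rw [ht htm])
      rw [h2] at h1
      linarith)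
  exact ⟨c, hc.mono fun t ht => by linarith⟩

/-- By Lebesgue differentiation the integrand is almost everywhere the derivative of its primitive.
This turns the weak formulation on all intervals (0, S) into one at almost every time. -/
lemma ae_eq_zero_of_forall_integral_eq_zero {T : ℝ} {f : ℝ → ℝ}
    (hf : IntervalIntegrable f volume 0 T) (hT : 0 < T)
    (h : ∀ S ∈ Ioo 0 T, ∫ t in (0 : ℝ)..S, f t = 0) :
    ∀ᵐ t ∂(volume.restrict (Ioo 0 T)), f t = 0 := by
  filter_upwards [ae_restrict_of_ae hf.ae_hasDerivAt_integral, ae_restrict_mem measurableSet_Ioo]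
    with t ht htm
  have h1 := ht (by rw [uIcc_of_le hT.le]; exact Ioo_subset_Icc_self htm) 0 (by simp)
  have h2 : (fun x => ∫ s in (0 : ℝ)..x, f s) =ᶠ[𝓝 t] fun _ => 0 := by
    filter_upwards [isOpen_Ioo.mem_nhds htm] with s hs using h s hs
  rw [← h1.deriv, h2.deriv_eq]; simp

/-- Every interval (0, u) has positive measure. Limits as t → 0⁺ outside a null set are therefore
unique. -/
lemma neBot_nhdsGT_inf_ae : (𝓝[>] (0 : ℝ) ⊓ ae volume).NeBot := by
  rw [Filter.inf_neBot_iff]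
  intro s hs s' hs'
  obtain ⟨u, hu, hsub⟩ := mem_nhdsGT_iff_exists_Ioo_subset.1 hs
  by_contra hne
  have hss : Ioo 0 u ⊆ s'ᶜ := fun x hx hx' => hne ⟨x, hsub hx, hx'⟩
  have h0 : volume (Ioo 0 u) = 0 := measure_mono_null hss hs'
  rw [Real.volume_Ioo, ENNReal.ofReal_eq_zero] at h0
  have : (0 : ℝ) < u := hu
  linarith

/-- The right-hand side is continuous down to t = 0, where its value is `c`; this must be the limit
of `f` outside a null set. -/
lemma eq_integral_of_tendsto_zero {T : ℝ} (hT : 0 < T) {f g : ℝ → ℝ} {c : ℝ}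
    (hg : IntegrableOn g (Ioo 0 T)) (hf : Tendsto f (𝓝[>] (0 : ℝ) ⊓ ae volume) (𝓝 0))
    (h : ∀ᵐ t ∂(volume.restrict (Ioo 0 T)), f t = c + ∫ s in (0 : ℝ)..t, g s) : c = 0 := by
  have := neBot_nhdsGT_inf_ae
  have hgi : IntervalIntegrable g volume 0 T := by
    rw [intervalIntegrable_iff_integrableOn_Ioo_of_le hT.le]; exact hg
  have hcont : ContinuousOn (fun t => ∫ s in (0 : ℝ)..t, g s) (Icc 0 T) := by
    have := (hgi.absolutelyContinuousOnInterval_intervalIntegral (c := 0) (by simp)).continuousOn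
    rwa [uIcc_of_le hT.le] at this
  have h1 : Tendsto (fun t => c + ∫ s in (0 : ℝ)..t, g s) (𝓝[>] (0 : ℝ)) (𝓝 (c + 0)) := by
    refine tendsto_const_nhds.add ?_
    have := (hcont 0 ⟨le_rfl, hT.le⟩).mono_left (nhdsWithin_mono 0 Ioo_subset_Icc_self)
    simp only [intervalIntegral.integral_same] at this
    rwa [nhdsWithin_Ioo_eq_nhdsGT hT] at this
  have h2 : f =ᶠ[𝓝[>] (0 : ℝ) ⊓ ae volume] fun t => c + ∫ s in (0 : ℝ)..t, g s := by
    rw [ae_restrict_iff' measurableSet_Ioo] at h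
    have hm : ∀ᶠ t in 𝓝[>] (0 : ℝ) ⊓ ae volume, t ∈ Ioo 0 T :=
      Filter.mem_inf_of_left (Ioo_mem_nhdsGT hT)
    have h' : ∀ᶠ t in 𝓝[>] (0 : ℝ) ⊓ ae volume, t ∈ Ioo 0 T → f t = c + ∫ s in (0 : ℝ)..t, g s :=
      Filter.mem_inf_of_right h
    filter_upwards [hm, h'] with t ht ht' using ht' ht
  have h3 := tendsto_nhds_unique (hf.congr' h2) (h1.mono_left inf_le_left)
  linarith

/-! ### Fubini on the cylinder -/

lemma restrict_cyl (Ω : Set R3) (T : ℝ) :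
    (volume.restrict (cyl Ω T) : Measure (R3 × ℝ)) =
      (volume.restrict Ω).prod (volume.restrict (Ioo 0 T)) := by
  rw [Measure.prod_restrict]; rfl

lemma integrableOn_integral_slice {Ω : Set R3} {T : ℝ} {F : R3 × ℝ → ℝ}
    (hF : IntegrableOn F (cyl Ω T)) : IntegrableOn (fun t => ∫ x in Ω, F (x, t)) (Ioo 0 T) := by
  rw [IntegrableOn, restrict_cyl] at hF
  exact hF.integral_prod_right

lemma intervalIntegrable_of_integrableOn_Ioo {S T : ℝ} (hS : S ∈ Icc 0 T) {f : ℝ → ℝ}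
    (hf : IntegrableOn f (Ioo 0 T)) : IntervalIntegrable f volume 0 S := by
  rw [intervalIntegrable_iff_integrableOn_Ioo_of_le hS.1]
  exact hf.mono_set (Ioo_subset_Ioo_right hS.2)

lemma ae_integrable_slice {Ω : Set R3} {T : ℝ} {F : R3 × ℝ → ℝ}
    (hF : IntegrableOn F (cyl Ω T)) :
    ∀ᵐ t ∂(volume.restrict (Ioo 0 T)), IntegrableOn (fun x => F (x, t)) Ω := by
  rw [IntegrableOn, restrict_cyl] at hF
  exact hF.prod_left_ae

lemma integral_cyl {Ω : Set R3} {T : ℝ} {F : R3 × ℝ → ℝ} (hF : IntegrableOn F (cyl Ω T)) :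
    ∫ p in cyl Ω T, F p = ∫ t in Ioo 0 T, ∫ x in Ω, F (x, t) := by
  rw [IntegrableOn, restrict_cyl] at hF
  rw [restrict_cyl, integral_prod_symm _ hF]

lemma isFiniteMeasure_restrict_cyl {Ω : Set R3} (hb : Bornology.IsBounded Ω) (T : ℝ) :
    IsFiniteMeasure (volume.restrict (cyl Ω T)) := by
  have := isFiniteMeasure_restrict hb
  rw [restrict_cyl]; infer_instance

lemma MemLp.integrable_inner_two {X : Type*} [MeasurableSpace X] {μ : Measure X} {f g : X → R3}
    (hf : MemLp f 2 μ) (hg : MemLp g 2 μ) : Integrable (fun x => (inner ℝ (f x) (g x) : ℝ)) μ := by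
  have h : Integrable (fun x => ‖f x‖ ^ 2 + ‖g x‖ ^ 2) μ :=
    ((memLp_two_iff_integrable_sq_norm hf.1).1 hf).add
      ((memLp_two_iff_integrable_sq_norm hg.1).1 hg)
  refine h.mono' (hf.1.inner hg.1) (ae_of_all _ fun x => ?_)
  refine (norm_inner_le_norm _ _).trans ?_
  nlinarith [sq_nonneg (‖f x‖ - ‖g x‖), sq_nonneg (‖f x‖), sq_nonneg (‖g x‖)]

lemma MemLp.cross_of_bound {X : Type*} [MeasurableSpace X] {μ : Measure X} {f g : X → R3}
    (hf : MemLp f 2 μ) (hg : AEStronglyMeasurable g μ) {C : ℝ} (hC : ∀ᵐ x ∂μ, ‖g x‖ ≤ C) :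
    MemLp (fun x => cross (f x) (g x)) 2 μ := by
  refine hf.of_le_mul (c := C) (continuous_cross.comp_aestronglyMeasurable (hf.1.prodMk hg)) ?_
  filter_upwards [hC] with x hx
  rw [mul_comm]
  exact (norm_cross_le _ _).trans (mul_le_mul_of_nonneg_left hx (norm_nonneg _))

lemma MemLp.bound_cross {X : Type*} [MeasurableSpace X] {μ : Measure X} {f g : X → R3}
    (hf : MemLp f 2 μ) (hg : AEStronglyMeasurable g μ) {C : ℝ} (hC : ∀ᵐ x ∂μ, ‖g x‖ ≤ C) :
    MemLp (fun x => cross (g x) (f x)) 2 μ := by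
  refine hf.of_le_mul (c := C) (continuous_cross.comp_aestronglyMeasurable (hg.prodMk hf.1)) ?_
  filter_upwards [hC] with x hx
  exact (norm_cross_le _ _).trans (mul_le_mul_of_nonneg_right hx (norm_nonneg _))

lemma isOpen_cyl {Ω : Set R3} (hΩ : IsOpen Ω) (T : ℝ) : IsOpen (cyl Ω T) := hΩ.prod isOpen_Ioo

lemma cyl_subset (Ω : Set R3) (T : ℝ) : cyl Ω T ⊆ closure Ω ×ˢ Icc 0 T :=
  prod_mono subset_closure Ioo_subset_Icc_self

lemma exists_bound_on_cyl {Ω : Set R3} (hb : Bornology.IsBounded Ω) {T : ℝ} {Y : Type*}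
    [NormedAddCommGroup Y] {f : R3 × ℝ → Y} (hf : ContinuousOn f (closure Ω ×ˢ Icc 0 T)) :
    ∃ C, ∀ p ∈ closure Ω ×ˢ Icc 0 T, ‖f p‖ ≤ C :=
  (hb.isCompact_closure.prod isCompact_Icc).exists_bound_of_continuousOn hf

lemma memLp_cyl_of_continuous {Ω : Set R3} (hΩ : IsOpen Ω) (hb : Bornology.IsBounded Ω) (T : ℝ)
    {f : R3 × ℝ → R3} (hf : Continuous f) : MemLp f 2 (volume.restrict (cyl Ω T)) := by
  have := isFiniteMeasure_restrict_cyl hb T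
  obtain ⟨C, hC⟩ := exists_bound_on_cyl hb (T := T) hf.continuousOn
  exact MemLp.of_bound hf.aestronglyMeasurable C
    ((ae_restrict_mem (isOpen_cyl hΩ T).measurableSet).mono fun p hp => hC p (cyl_subset Ω T hp))

lemma integrableOn_cyl_inner {Ω : Set R3} (hΩ : IsOpen Ω) (hb : Bornology.IsBounded Ω) {T : ℝ}
    {f g : R3 × ℝ → R3} (hf : Continuous f) (hg : MemLp g 2 (volume.restrict (cyl Ω T))) :
    IntegrableOn (fun p => (inner ℝ (f p) (g p) : ℝ)) (cyl Ω T) :=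
  MemLp.integrable_inner_two (memLp_cyl_of_continuous hΩ hb T hf) hg

/-! ### The weak time derivative of a duality product -/

/-- The test field is ψ(t) times a spatial cut-off times `X`. The time derivative never falls on the
cut-off, so it is removed by dominated convergence without any boundary condition on `X`. -/
lemma weak_deriv_integral_inner {Ω : Set R3} (hb : Bornology.IsBounded Ω) {ρ : R3 → ℝ}
    (hρ : IsDefiningFunction Ω ρ) {T : ℝ} {v D X : R3 × ℝ → R3}
    (hv : MemLp v 2 (volume.restrict (cyl Ω T))) (hD : MemLp D 2 (volume.restrict (cyl Ω T)))
    (hvD : IsWeakDeriv (cyl Ω T) ((0, 1) : R3 × ℝ) v D) (hX : ContDiff ℝ ∞ X)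
    {ψ : ℝ → ℝ} (hψ : ContDiff ℝ ∞ ψ) (hψc : HasCompactSupport ψ) (hψs : tsupport ψ ⊆ Ioo 0 T) :
    ∫ t in Ioo 0 T, deriv ψ t * ∫ x in Ω, (inner ℝ (X (x, t)) (v (x, t)) : ℝ) =
      - ∫ t in Ioo 0 T, ψ t * ∫ x in Ω,
        ((inner ℝ (dt X (x, t)) (v (x, t)) : ℝ) + inner ℝ (X (x, t)) (D (x, t))) := by
  have hΩ := hρ.isOpen
  have := isFiniteMeasure_restrict_cyl hb T
  have hvi : IntegrableOn v (cyl Ω T) := hv.integrable (by norm_num)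
  have hDi : IntegrableOn D (cyl Ω T) := hD.integrable (by norm_num)
  have hdX := contDiff_dt hX
  have hψ' : Continuous (deriv ψ) := hψ.continuous_deriv (by simp)
  set A : R3 × ℝ → ℝ := fun p => inner ℝ (X p) (v p) with hA
  set B : R3 × ℝ → ℝ := fun p => (inner ℝ (dt X p) (v p) : ℝ) + inner ℝ (X p) (D p) with hB
  have hAi : IntegrableOn A (cyl Ω T) := integrableOn_cyl_inner hΩ hb hX.continuous hv
  have hBi : IntegrableOn B (cyl Ω T) := (integrableOn_cyl_inner hΩ hb hdX.continuous hv).add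
    (integrableOn_cyl_inner hΩ hb hX.continuous hD)
  have hmul : ∀ {φ : ℝ → ℝ} {H : R3 × ℝ → ℝ}, Continuous φ → HasCompactSupport φ →
      IntegrableOn H (cyl Ω T) → IntegrableOn (fun p : R3 × ℝ => φ p.2 * H p) (cyl Ω T) := by
    intro φ H hφ hφc hH
    obtain ⟨C, hC⟩ := hφc.exists_bound_of_continuous hφ
    exact hH.bdd_mul (hφ.comp continuous_snd).aestronglyMeasurable (ae_of_all _ fun p => hC p.2)
  set F : R3 × ℝ → ℝ := fun p => deriv ψ p.2 * A p + ψ p.2 * B p with hF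
  have hFi : IntegrableOn F (cyl Ω T) :=
    (hmul hψ' hψc.deriv hAi).add (hmul hψ.continuous hψc hBi)
  have hcut : ∀ n : ℝ, 0 < n → ∫ p in cyl Ω T, cutoff ρ n p.1 * F p = 0 := by
    intro n hn
    set χ : R3 × ℝ → ℝ := fun p => ψ p.2 * cutoff ρ n p.1 with hχ
    have hχd : ContDiff ℝ ∞ χ :=
      (hψ.comp contDiff_snd).mul ((contDiff_cutoff hρ.smooth n).comp contDiff_fst)
    have hsub : tsupport χ ⊆ tsupport (cutoff ρ n) ×ˢ tsupport ψ := by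
      refine closure_minimal (fun p hp => ?_) ((isClosed_tsupport _).prod (isClosed_tsupport _))
      have hp' : χ p ≠ 0 := hp
      exact ⟨subset_tsupport _ (right_ne_zero_of_mul hp'), subset_tsupport _
        (left_ne_zero_of_mul hp')⟩
    have hχc : HasCompactSupport χ :=
      ((hasCompactSupport_cutoff hb hρ hn).prod hψc).of_isClosed_subset (isClosed_tsupport _) hsub
    have hχs : tsupport χ ⊆ cyl Ω T :=
      hsub.trans (prod_mono (tsupport_cutoff_subset_of_pos hρ hn) hψs)
    have hΦ : ContDiff ℝ ∞ fun p => χ p • X p := hχd.smul hX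
    have hparts := hvD.integral_inner hvi hDi hΦ hχc.smul_right
      ((closure_mono (Function.support_smul_subset_left _ _)).trans hχs)
    have hder : ∀ p : R3 × ℝ, fderiv ℝ (fun p => χ p • X p) p (0, 1) =
        χ p • dt X p + (deriv ψ p.2 * cutoff ρ n p.1) • X p := by
      intro p
      rw [← dt_eq (hΦ.differentiable (by simp) p)]
      have h1 : HasDerivAt (fun s => χ (p.1, s)) (deriv ψ p.2 * cutoff ρ n p.1) p.2 :=
        ((hψ.differentiable (by simp) p.2).hasDerivAt).mul_const (cutoff ρ n p.1)
      exact (h1.smul (hasDerivAt_dt hX p.1 p.2)).deriv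
    have hEq : ∀ p, cutoff ρ n p.1 * F p =
        (inner ℝ (fderiv ℝ (fun p => χ p • X p) p (0, 1)) (v p) : ℝ) +
          inner ℝ (χ p • X p) (D p) := by
      intro p
      rw [hder p]
      simp only [hF, hA, hB, hχ, inner_add_left, real_inner_smul_left]
      ring
    simp only [hEq]
    rw [integral_add, hparts, neg_add_cancel]
    · exact integrableOn_cyl_inner hΩ hb
        ((hΦ.continuous_fderiv (by simp)).clm_apply continuous_const) hv
    · exact integrableOn_cyl_inner hΩ hb hΦ.continuous hD
  have hlim : Tendsto (fun n : ℕ => ∫ p in cyl Ω T, cutoff ρ ((n : ℝ) + 1) p.1 * F p) atTop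
      (𝓝 (∫ p in cyl Ω T, F p)) := by
    refine tendsto_integral_of_dominated_convergence (fun p => ‖F p‖) (fun n => ?_) hFi.norm
      (fun n => ae_of_all _ fun p => ?_) ?_
    · exact ((contDiff_cutoff hρ.smooth _).continuous.comp
        continuous_fst).aestronglyMeasurable.mul hFi.1
    · rw [norm_mul]
      exact mul_le_of_le_one_left (norm_nonneg _) (abs_cutoff_le_one _ _ _)
    · filter_upwards [ae_restrict_mem (isOpen_cyl hΩ T).measurableSet] with p hp
      have hρx : ρ p.1 < 0 := by
        have := hp.1
        rw [hρ.eq_sublevel] at this; exact this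
      refine tendsto_const_nhds.congr' ?_
      filter_upwards [eventually_cutoff_eq_one hρx] with n hn
      rw [hn, one_mul]
  simp only [hcut _ (by positivity : (0 : ℝ) < ((_ : ℕ) : ℝ) + 1)] at hlim
  have hzero := tendsto_nhds_unique hlim tendsto_const_nhds
  simp only [hF] at hzero
  rw [integral_add (hmul hψ' hψc.deriv hAi) (hmul hψ.continuous hψc hBi),
    integral_cyl (hmul hψ' hψc.deriv hAi), integral_cyl (hmul hψ.continuous hψc hBi)] at hzero
  simp only [integral_const_mul] at hzero
  exact eq_neg_of_add_eq_zero_left hzero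

/-! ### Convergence of duality products -/

lemma tendsto_integral_inner_of_normSq {Ω : Set R3} (hb : Bornology.IsBounded Ω)
    (hΩ : IsOpen Ω) {l : Filter ℝ} {X w : ℝ → R3 → R3} {C : ℝ}
    (hC : ∀ᶠ t in l, ∀ x ∈ Ω, ‖X t x‖ ≤ C)
    (hw : ∀ᶠ t in l, MemLp (w t) 2 (volume.restrict Ω))
    (h : Tendsto (fun t => normSq Ω (w t)) l (𝓝 0)) :
    Tendsto (fun t => ∫ x in Ω, (inner ℝ (X t x) (w t x) : ℝ)) l (𝓝 0) := by
  have := isFiniteMeasure_restrict hb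
  have key : Tendsto (fun t => ∫ x in Ω, ‖w t x‖) l (𝓝 0) := by
    rw [Metric.tendsto_nhds]
    intro ε hε
    set V := (volume.restrict Ω).real univ with hV
    have hV0 : 0 ≤ V := measureReal_nonneg
    -- From (‖w‖ - a)² ≥ 0 one has 2a∫‖w‖ ≤ ∫‖w‖² + a²V. With aV ≤ ε/2 and ∫‖w‖² < aε this gives
    -- ∫‖w‖ < ε.
    set a := ε / 2 / (V + 1) with ha
    have ha0 : 0 < a := by positivity
    have haV : a * V ≤ ε / 2 := by
      rw [ha, div_mul_eq_mul_div, div_le_iff₀ (by positivity)]; nlinarith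
    filter_upwards [hw, (Metric.tendsto_nhds.1 h) (a * ε) (by positivity)] with t ht ht'
    rw [Real.dist_0_eq_abs] at ht' ⊢
    have hi1 : Integrable (fun x => ‖w t x‖) (volume.restrict Ω) :=
      (ht.integrable (by norm_num)).norm
    have hi2 := (memLp_two_iff_integrable_sq_norm ht.1).1 ht
    have h1 : 0 ≤ ∫ x in Ω, (‖w t x‖ ^ 2 - 2 * a * ‖w t x‖ + a ^ 2) :=
      integral_nonneg fun x => by
        show 0 ≤ ‖w t x‖ ^ 2 - 2 * a * ‖w t x‖ + a ^ 2
        nlinarith [sq_nonneg (‖w t x‖ - a)]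
    rw [integral_add (f := fun x => ‖w t x‖ ^ 2 - 2 * a * ‖w t x‖)
      (hi2.sub (hi1.const_mul _)) (integrable_const _), integral_sub hi2 (hi1.const_mul _), integral_const_mul, integral_const, smul_eq_mul,
      ← hV] at h1
    have h2 : ∫ x in Ω, ‖w t x‖ ^ 2 < a * ε := (le_abs_self _).trans_lt ht'
    rw [abs_of_nonneg (integral_nonneg fun x => norm_nonneg _)]
    by_contra hcon
    rw [not_lt] at hcon
    nlinarith [mul_le_mul_of_nonneg_left hcon ha0.le, mul_le_mul_of_nonneg_left haV ha0.le]
  refine squeeze_zero_norm' (a := fun t => C * ∫ x in Ω, ‖w t x‖) ?_ (by simpa using key.const_mul C)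
  filter_upwards [hC, hw] with t hCt hwt
  have hi1 : Integrable (fun x => ‖w t x‖) (volume.restrict Ω) :=
    (hwt.integrable (by norm_num)).norm
  rw [← integral_const_mul]
  refine norm_integral_le_of_norm_le (hi1.const_mul C) ?_
  filter_upwards [ae_restrict_mem hΩ.measurableSet] with x hx
  exact (norm_inner_le_norm _ _).trans (mul_le_mul_of_nonneg_right (hCt x hx) (norm_nonneg _))

/-- The difference splits into m₂(t) - m* and m(0) - m(t): the first tends to zero in L² by the
initial condition, the second is handled by dominated convergence. -/
lemma tendsto_integral_inner_initial {Ω : Set R3} (hb : Bornology.IsBounded Ω)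
    (hΩ : IsOpen Ω) {T : ℝ} (hT : 0 < T) {X m m₂ : R3 × ℝ → R3} {ms : R3 → R3}
    (hX : Continuous X) (hm : Continuous m) (hms : slice m 0 =ᵐ[volume.restrict Ω] ms)
    (hms2 : MemLp ms 2 (volume.restrict Ω))
    (hm₂ : ∀ᵐ t ∂(volume.restrict (Ioo 0 T)), MemLp (slice m₂ t) 2 (volume.restrict Ω))
    (h : Tendsto (fun t => normSq Ω (fun x => m₂ (x, t) - ms x)) (𝓝[>] (0 : ℝ) ⊓ ae volume)
      (𝓝 0)) :
    Tendsto (fun t => ∫ x in Ω, (inner ℝ (X (x, t)) (m₂ (x, t) - m (x, t)) : ℝ))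
      (𝓝[>] (0 : ℝ) ⊓ ae volume) (𝓝 0) := by
  have := isFiniteMeasure_restrict hb
  have hmemT : ∀ᶠ t in 𝓝[>] (0 : ℝ) ⊓ ae volume, t ∈ Ioo 0 T :=
    Filter.mem_inf_of_left (Ioo_mem_nhdsGT hT)
  obtain ⟨C, hC⟩ := exists_bound_on_cyl hb (T := T) hX.continuousOn
  obtain ⟨M, hM⟩ := exists_bound_on_cyl hb (T := T) hm.continuousOn
  have hms_bd : ∀ᵐ x ∂(volume.restrict Ω), ‖m (x, 0)‖ ≤ M := by
    filter_upwards [ae_restrict_mem hΩ.measurableSet] with x hx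
    exact hM (x, 0) ⟨subset_closure hx, le_rfl, hT.le⟩
  have hw : ∀ᶠ t in 𝓝[>] (0 : ℝ) ⊓ ae volume,
      MemLp (fun x => m₂ (x, t) - ms x) 2 (volume.restrict Ω) := by
    rw [ae_restrict_iff' measurableSet_Ioo] at hm₂
    have h' : ∀ᶠ t in 𝓝[>] (0 : ℝ) ⊓ ae volume,
      t ∈ Ioo 0 T → MemLp (slice m₂ t) 2 (volume.restrict Ω) := Filter.mem_inf_of_right hm₂
    filter_upwards [hmemT, h'] with t ht ht'
    exact (ht' ht).sub hms2
  have h1 := tendsto_integral_inner_of_normSq hb hΩ (X := fun t x => X (x, t))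
    (w := fun t x => m₂ (x, t) - ms x) (C := C)
    (hmemT.mono fun t ht x hx => hC (x, t) ⟨subset_closure hx, Ioo_subset_Icc_self ht⟩) hw h
  have h2 : Tendsto (fun t => ∫ x in Ω, (inner ℝ (X (x, t)) (m (x, 0) - m (x, t)) : ℝ))
      (𝓝[>] (0 : ℝ)) (𝓝 (∫ x in Ω, (0 : ℝ))) := by
    refine tendsto_integral_filter_of_dominated_convergence (fun _ => C * (M + M)) ?_ ?_
      (integrable_const _) (ae_of_all _ fun x => ?_)
    · exact Eventually.of_forall fun t => by
        have h3 : Continuous fun x => (inner ℝ (X (x, t)) (m (x, 0) - m (x, t)) : ℝ) := by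
          fun_prop
        exact h3.aestronglyMeasurable
    · filter_upwards [Ioo_mem_nhdsGT hT] with t ht
      filter_upwards [ae_restrict_mem hΩ.measurableSet, hms_bd] with x hx hx0
      have hxt : (x, t) ∈ closure Ω ×ˢ Icc 0 T := ⟨subset_closure hx, Ioo_subset_Icc_self ht⟩
      refine (norm_inner_le_norm _ _).trans (mul_le_mul (hC _ hxt)
        ((norm_sub_le _ _).trans (add_le_add hx0 (hM _ hxt))) (norm_nonneg _)
        ((norm_nonneg _).trans (hC _ hxt)))
    · have h3 : Continuous fun t => (inner ℝ (X (x, t)) (m (x, 0) - m (x, t)) : ℝ) := by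
        fun_prop
      have h4 := (h3.tendsto 0).mono_left (nhdsWithin_le_nhds (s := Ioi 0))
      simpa using h4
  rw [integral_zero] at h2
  have h5 := h1.add (h2.mono_left (inf_le_left (b := ae volume)))
  rw [add_zero] at h5
  refine h5.congr' ?_
  filter_upwards [hmemT, hw] with t ht hwt
  have hXi : MemLp (fun x => X (x, t)) 2 (volume.restrict Ω) :=
    MemLp.of_bound (by fun_prop : Continuous fun x => X (x, t)).aestronglyMeasurable C
      ((ae_restrict_mem hΩ.measurableSet).mono fun x hx =>
        hC (x, t) ⟨subset_closure hx, Ioo_subset_Icc_self ht⟩)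
  have hmi : MemLp (fun x => m (x, 0) - m (x, t)) 2 (volume.restrict Ω) :=
    MemLp.of_bound (by fun_prop : Continuous fun x => m (x, 0) - m (x, t)).aestronglyMeasurable
      (M + M) (by
        filter_upwards [ae_restrict_mem hΩ.measurableSet, hms_bd] with x hx hx0
        exact (norm_sub_le _ _).trans (add_le_add hx0
          (hM (x, t) ⟨subset_closure hx, Ioo_subset_Icc_self ht⟩)))
  rw [← integral_add (MemLp.integrable_inner_two hXi hwt) (MemLp.integrable_inner_two hXi hmi)]
  refine integral_congr_ae ?_
  filter_upwards [hms] with x hx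
  have hx' : m (x, 0) = ms x := hx
  rw [← inner_add_right, hx']
  congr 1
  abel

/-! ### The homogeneous Neumann condition -/

/-- The Neumann condition in the form required by the divergence theorem: the unit normal is
replaced by the nonzero gradient of `ρ`, expanded in the canonical basis. -/
lemma sum_fderiv_smul_dx_eq_zero {Ω : Set R3} {ρ : R3 → ℝ} (hρ : IsDefiningFunction Ω ρ)
    {m : R3 × ℝ → R3} {x : R3} {t : ℝ} (hx : x ∈ frontier Ω)
    (h : fderiv ℝ (slice m t) x (normal ρ x) = 0) :
    ∑ i, fderiv ℝ ρ x (e i) • dx i m (x, t) = 0 := by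
  have hρ0 : ρ x = 0 := by
    rw [hρ.isOpen.frontier_eq, hρ.eq_sublevel] at hx
    refine le_antisymm (hρ.nonpos_of_mem_closure (by rw [hρ.eq_sublevel]; exact hx.1)) ?_
    exact not_lt.1 hx.2
  have hg := hρ.gradient_ne_zero x hρ0
  rw [normal, map_smul, smul_eq_zero, inv_eq_zero, norm_eq_zero, or_iff_right hg] at h
  have hgrad : gradient ρ x = ∑ i, fderiv ℝ ρ x (e i) • e i := by
    have := (EuclideanSpace.basisFun (Fin 3) ℝ).sum_repr' (gradient ρ x)
    rw [← this]
    refine Finset.sum_congr rfl fun i _ => ?_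
    rw [real_inner_comm, gradient, InnerProductSpace.toDual_symm_apply]
    simp [e]
  rw [hgrad, map_sum] at h
  simpa only [map_smul, fderiv_slice] using h

/-- At a fixed boundary point the Neumann condition holds for a whole interval of times and can be
differentiated in t; the weights ∂ᵢρ do not depend on t. -/
lemma sum_fderiv_smul_dx_dt_eq_zero {Ω : Set R3} {ρ : R3 → ℝ} (hρ : IsDefiningFunction Ω ρ)
    {m : R3 × ℝ → R3} (hm : ContDiff ℝ ∞ m) {T : ℝ} {x : R3} (hx : x ∈ frontier Ω)
    (h : ∀ t ∈ Icc 0 T, fderiv ℝ (slice m t) x (normal ρ x) = 0) {t : ℝ} (ht : t ∈ Ioo 0 T) :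
    ∑ i, fderiv ℝ ρ x (e i) • dx i (dt m) (x, t) = 0 := by
  have h1 : HasDerivAt (fun s => ∑ i, fderiv ℝ ρ x (e i) • dx i m (x, s))
      (∑ i, fderiv ℝ ρ x (e i) • dx i (dt m) (x, t)) t := by
    refine HasDerivAt.fun_sum fun i _ => ?_
    rw [dx_dt_comm hm]
    exact (hasDerivAt_dt (contDiff_dx hm i) x t).const_smul (fderiv ℝ ρ x (e i))
  have h2 : (fun s => ∑ i, fderiv ℝ ρ x (e i) • dx i m (x, s)) =ᶠ[𝓝 t] fun _ => 0 := by
    filter_upwards [isOpen_Ioo.mem_nhds ht] with s hs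
    exact sum_fderiv_smul_dx_eq_zero hρ hx (h s (Ioo_subset_Icc_self hs))
  rw [← h1.deriv, h2.deriv_eq]; simp

/-- The evolution of `⟨∇m, ∇v⟩` for a smooth field `m` which satisfies the Neumann condition and
a field `v` with vanishing initial value. -/
lemma ae_integral_inner_grad_eq {Ω : Set R3} (hb : Bornology.IsBounded Ω) {ρ : R3 → ℝ}
    (hρ : IsDefiningFunction Ω ρ) {T : ℝ} (hT : 0 < T) {m v D : R3 × ℝ → R3}
    {G : Fin 3 → R3 × ℝ → R3} (hm : ContDiff ℝ ∞ m)
    (hN : ∀ x ∈ frontier Ω, ∀ t ∈ Icc 0 T, fderiv ℝ (slice m t) x (normal ρ x) = 0)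
    (hv : IsH1Cyl Ω T v G D)
    (hs : ∀ᵐ t ∂(volume.restrict (Ioo 0 T)), IsH1 Ω (slice v t) fun i => slice (G i) t)
    (h0 : Tendsto (fun t => ∫ x in Ω, (inner ℝ (lap m (x, t)) (v (x, t)) : ℝ))
      (𝓝[>] (0 : ℝ) ⊓ ae volume) (𝓝 0)) :
    ∀ᵐ S ∂(volume.restrict (Ioo 0 T)),
      ∫ x in Ω, ∑ i, (inner ℝ (dx i m (x, S)) (G i (x, S)) : ℝ) =
        ∫ t in (0 : ℝ)..S, ∫ x in Ω, ((∑ i, (inner ℝ (dx i (dt m) (x, t)) (G i (x, t)) : ℝ)) -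
          inner ℝ (lap m (x, t)) (D (x, t))) := by
  have hΩ := hρ.isOpen
  have hlap := contDiff_lap hm
  have hdm := contDiff_dt hm
  -- The weak gradient of `v` need not have a time derivative, so ⟨∇m, ∇v⟩ is first rewritten as
  -- -⟨Δm, v⟩, in which only `v` itself is differentiated in time. The function `g` is the time
  -- derivative of ⟨Δm, v⟩.
  set g : ℝ → ℝ := fun t => ∫ x in Ω, ((inner ℝ (dt (lap m) (x, t)) (v (x, t)) : ℝ) +
    inner ℝ (lap m (x, t)) (D (x, t))) with hg
  have hfi := integrableOn_integral_slice
    (integrableOn_cyl_inner hΩ hb hlap.continuous hv.memLp)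
  have hgI : IntegrableOn (fun p => (inner ℝ (dt (lap m) p) (v p) : ℝ) +
      inner ℝ (lap m p) (D p)) (cyl Ω T) :=
    (integrableOn_cyl_inner hΩ hb (contDiff_dt hlap).continuous hv.memLp).add
      (integrableOn_cyl_inner hΩ hb hlap.continuous hv.dt_memLp)
  have hgi : IntegrableOn g (Ioo 0 T) := integrableOn_integral_slice hgI
  obtain ⟨c, hc⟩ := ae_eq_const_add_integral_of_weak_deriv hT hfi hgi fun ψ hψ hψc hψs =>
    weak_deriv_integral_inner hb hρ hv.memLp hv.dt_memLp hv.dt_weak hlap hψ hψc hψs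
  have hc0 := eq_integral_of_tendsto_zero hT hgi h0 hc
  subst hc0
  have hqI : IntegrableOn (fun p => (∑ i, (inner ℝ (dx i (dt m) p) (G i p) : ℝ)) -
      inner ℝ (lap m p) (D p)) (cyl Ω T) :=
    (integrable_finsetSum _ fun i _ => integrableOn_cyl_inner hΩ hb (contDiff_dx hdm i).continuous
      (hv.grad_memLp i)).sub (integrableOn_cyl_inner hΩ hb hlap.continuous hv.dt_memLp)
  -- The divergence theorem for ∂ₜm, which inherits the Neumann condition, turns ⟨∂ₜΔm, v⟩ back into
  -- -⟨∇∂ₜm, ∇v⟩.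
  have hgq : ∀ᵐ t ∂(volume.restrict (Ioo 0 T)), g t = - ∫ x in Ω,
      ((∑ i, (inner ℝ (dx i (dt m) (x, t)) (G i (x, t)) : ℝ)) -
        inner ℝ (lap m (x, t)) (D (x, t))) := by
    filter_upwards [hs, ae_integrable_slice hgI, ae_integrable_slice hqI,
      ae_restrict_mem measurableSet_Ioo] with t hst hg1 hq1 ht
    have hdiv := integral_divergence_eq_zero hb hρ hst (X := fun i => slice (dx i (dt m)) t)
      (fun i => contDiff_slice (contDiff_dx hdm i) t)
      (fun x hx => sum_fderiv_smul_dx_dt_eq_zero hρ hm hx (hN x hx) ht)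
    rw [eq_neg_iff_add_eq_zero, hg, ← integral_add hg1 hq1, ← hdiv]
    refine integral_congr_ae (ae_of_all _ fun x => ?_)
    simp only [dt_lap hm, Finset.sum_add_distrib, sum_inner, fderiv_slice, slice]
    ring
  filter_upwards [hc, hs, ae_restrict_mem measurableSet_Ioo,
    ae_integrable_slice (integrableOn_cyl_inner hΩ hb hlap.continuous hv.memLp),
    ae_integrable_slice (integrable_finsetSum (f := fun i p => (inner ℝ (dx i m p) (G i p) : ℝ))
      Finset.univ fun i _ => integrableOn_cyl_inner hΩ hb
      (contDiff_dx hm i).continuous (hv.grad_memLp i))] with S hS hsS hSm hi1 hi2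
  have hdiv := integral_divergence_eq_zero hb hρ hsS (X := fun i => slice (dx i m) S)
    (fun i => contDiff_slice (contDiff_dx hm i) S)
    (fun x hx => sum_fderiv_smul_dx_eq_zero hρ hx (hN x hx S (Ioo_subset_Icc_self hSm)))
  have h1 : ∫ x in Ω, ∑ i, (inner ℝ (dx i m (x, S)) (G i (x, S)) : ℝ) =
      - ∫ x in Ω, (inner ℝ (lap m (x, S)) (v (x, S)) : ℝ) := by
    rw [eq_neg_iff_add_eq_zero, ← integral_add hi2 hi1, ← hdiv]
    refine integral_congr_ae (ae_of_all _ fun x => ?_)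
    simp only [lap, Finset.sum_add_distrib, sum_inner, fderiv_slice, slice]
  rw [h1, hS, zero_add, ← intervalIntegral.integral_neg]
  refine intervalIntegral.integral_congr_ae ?_
  rw [ae_restrict_iff' measurableSet_Ioo] at hgq
  filter_upwards [hgq] with t ht htm
  rw [uIoc_of_le hSm.1.le] at htm
  rw [ht ⟨htm.1, htm.2.trans_lt hSm.2⟩, neg_neg]

/-! ### Statements at almost every time, and products of vector fields -/

lemma intervalIntegral_congr_of_ae {T S : ℝ} (hS : S ∈ Ico 0 T) {f g : ℝ → ℝ}
    (h : ∀ᵐ t ∂(volume.restrict (Ioo 0 T)), f t = g t) :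
    ∫ t in (0 : ℝ)..S, f t = ∫ t in (0 : ℝ)..S, g t := by
  refine intervalIntegral.integral_congr_ae ?_
  rw [ae_restrict_iff' measurableSet_Ioo] at h
  filter_upwards [h] with t ht htm
  rw [uIoc_of_le hS.1] at htm
  exact ht ⟨htm.1, htm.2.trans_lt hS.2⟩

lemma ae_Ioo_of_ae_Ioi {T : ℝ} {p : ℝ → Prop} (h : ∀ᵐ t ∂(volume.restrict (Ioi (0 : ℝ))), p t) :
    ∀ᵐ t ∂(volume.restrict (Ioo 0 T)), p t :=
  ae_restrict_of_ae_restrict_of_subset Ioo_subset_Ioi_self h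

lemma inner_cross_rotate (a b c : R3) :
    (inner ℝ a (cross b c) : ℝ) = inner ℝ b (cross c a) := by
  simp only [inner_eq_coord, cross_zero_apply, cross_one_apply, cross_two_apply]; ring

lemma MemLp.integrable_cross {X : Type*} [MeasurableSpace X] {μ : Measure X} {f g : X → R3}
    (hf : MemLp f 2 μ) (hg : MemLp g 2 μ) : Integrable (fun x => cross (f x) (g x)) μ := by
  have h : Integrable (fun x => ‖f x‖ ^ 2 + ‖g x‖ ^ 2) μ :=
    ((memLp_two_iff_integrable_sq_norm hf.1).1 hf).add
      ((memLp_two_iff_integrable_sq_norm hg.1).1 hg)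
  refine h.mono' (continuous_cross.comp_aestronglyMeasurable (hf.1.prodMk hg.1))
    (ae_of_all _ fun x => ?_)
  refine (norm_cross_le _ _).trans ?_
  nlinarith [sq_nonneg (‖f x‖ - ‖g x‖), sq_nonneg (‖f x‖), sq_nonneg (‖g x‖)]

/-! ### Fields in `C([0, T]; C¹(Ω̄))` -/

lemma IsContC1.continuousOn_dx {Ω : Set R3} {T : ℝ} {κ : R3 × ℝ → R3} (h : IsContC1 Ω T κ)
    (i : Fin 3) : ContinuousOn (dx i κ) (Ω ×ˢ Icc 0 T) := by
  obtain ⟨Q, hQ, hQe⟩ := h.grad_cont i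
  exact (hQ.mono (prod_mono subset_closure le_rfl)).congr fun p hp => (hQe p.1 hp.1 p.2 hp.2).symm

lemma IsContC1.exists_bound {Ω : Set R3} (hb : Bornology.IsBounded Ω) {T : ℝ}
    {κ : R3 × ℝ → R3} (h : IsContC1 Ω T κ) :
    ∃ C, ∀ x ∈ Ω, ∀ t ∈ Icc 0 T, ‖κ (x, t)‖ ≤ C ∧ ∀ i, ‖dx i κ (x, t)‖ ≤ C := by
  obtain ⟨C, hC⟩ := exists_bound_on_cyl hb h.cont
  choose Q hQ hQe using h.grad_cont
  choose C' hC' using fun i => exists_bound_on_cyl hb (hQ i)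
  refine ⟨max C (∑ i, |C' i|), fun x hx t ht => ⟨(hC (x, t) ⟨subset_closure hx, ht⟩).trans
    (le_max_left _ _), fun i => ?_⟩⟩
  rw [← hQe i x hx t ht]
  exact ((hC' i (x, t) ⟨subset_closure hx, ht⟩).trans (le_abs_self _)).trans
    ((Finset.single_le_sum (f := fun i => |C' i|) (fun _ _ => abs_nonneg _)
      (Finset.mem_univ i)).trans (le_max_right _ _))

lemma aestronglyMeasurable_slice_of_continuousOn {Ω : Set R3} (hΩ : IsOpen Ω) {T t : ℝ}
    {κ : R3 × ℝ → R3} (h : ContinuousOn κ (Ω ×ˢ Icc 0 T)) (ht : t ∈ Icc 0 T) :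
    AEStronglyMeasurable (fun x => κ (x, t)) (volume.restrict Ω) :=
  (h.comp (continuous_id.prodMk continuous_const).continuousOn
    fun _ hx => ⟨hx, ht⟩).aestronglyMeasurable hΩ.measurableSet

lemma aestronglyMeasurable_cyl_of_continuousOn {Ω : Set R3} (hΩ : IsOpen Ω) {T : ℝ}
    {κ : R3 × ℝ → R3} (h : ContinuousOn κ (Ω ×ˢ Icc 0 T)) :
    AEStronglyMeasurable κ (volume.restrict (cyl Ω T)) :=
  (h.mono (prod_mono le_rfl Ioo_subset_Icc_self)).aestronglyMeasurable
    (isOpen_cyl hΩ T).measurableSet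

lemma continuousAt_of_continuousOn_prod {Ω : Set R3} {T t : ℝ} {κ : R3 × ℝ → R3}
    (h : ContinuousOn κ (Ω ×ˢ Icc 0 T)) {x : R3} (hx : x ∈ Ω) (ht : t ∈ Ioo 0 T) :
    ContinuousAt (fun s => κ (x, s)) t := by
  have h1 : ContinuousOn (fun s => κ (x, s)) (Icc 0 T) :=
    h.comp (continuous_const.prodMk continuous_id).continuousOn fun _ hs => ⟨hx, hs⟩
  exact h1.continuousAt (Icc_mem_nhds ht.1 ht.2)

lemma IsContC1.continuousOn {Ω : Set R3} {T : ℝ} {κ : R3 × ℝ → R3} (h : IsContC1 Ω T κ) :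
    ContinuousOn κ (Ω ×ˢ Icc 0 T) := h.cont.mono (prod_mono subset_closure le_rfl)

lemma continuousAt_integral_inner {Ω : Set R3} (hΩ : IsOpen Ω) {T t : ℝ} (ht : t ∈ Ioo 0 T)
    {κ : R3 × ℝ → R3} (h : ContinuousOn κ (Ω ×ˢ Icc 0 T)) {C : ℝ}
    (hC : ∀ x ∈ Ω, ∀ s ∈ Icc 0 T, ‖κ (x, s)‖ ≤ C) {A : R3 → R3} (hA : IntegrableOn A Ω) :
    ContinuousAt (fun s => ∫ x in Ω, (inner ℝ (κ (x, s)) (A x) : ℝ)) t := by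
  have hev : ∀ᶠ s in 𝓝 t, s ∈ Icc 0 T := Icc_mem_nhds ht.1 ht.2
  refine continuousAt_of_dominated (bound := fun x => C * ‖A x‖) ?_ ?_ (hA.norm.const_mul C) ?_
  · exact hev.mono fun s hs => (aestronglyMeasurable_slice_of_continuousOn hΩ h hs).inner hA.1
  · filter_upwards [hev] with s hs
    filter_upwards [ae_restrict_mem hΩ.measurableSet] with x hx
    exact (norm_inner_le_norm _ _).trans (mul_le_mul_of_nonneg_right (hC x hx s hs)
      (norm_nonneg _))
  · filter_upwards [ae_restrict_mem hΩ.measurableSet] with x hx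
    exact (continuousAt_of_continuousOn_prod h hx ht).inner continuousAt_const

/-- An identity which is linear in a field and its gradient and holds, for almost every time,
for every fixed smooth field also holds along a continuous family of smooth fields. -/
lemma ae_integral_eq_zero_of_forall_smooth {Ω : Set R3} (hΩ : IsOpen Ω)
    (hb : Bornology.IsBounded Ω) {T : ℝ} {κ : R3 × ℝ → R3} (hκ : IsContC1 Ω T κ)
    (hsm : ∀ s ∈ Ioo 0 T, ∃ g : R3 → R3, ContDiff ℝ ∞ g ∧ ∀ x ∈ Ω, κ (x, s) = g x)
    {A : R3 × ℝ → R3} {B : Fin 3 → R3 × ℝ → R3}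
    (hA : ∀ᵐ t ∂(volume.restrict (Ioo 0 T)), IntegrableOn (slice A t) Ω)
    (hB : ∀ i, ∀ᵐ t ∂(volume.restrict (Ioo 0 T)), IntegrableOn (slice (B i) t) Ω)
    (h : ∀ g : R3 → R3, ContDiff ℝ ∞ g → ∀ᵐ t ∂(volume.restrict (Ioo 0 T)),
      ∫ x in Ω, ((inner ℝ (g x) (A (x, t)) : ℝ) +
        ∑ i, (inner ℝ (fderiv ℝ g x (e i)) (B i (x, t)) : ℝ)) = 0) :
    ∀ᵐ t ∂(volume.restrict (Ioo 0 T)),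
      ∫ x in Ω, ((inner ℝ (κ (x, t)) (A (x, t)) : ℝ) +
        ∑ i, (inner ℝ (dx i κ (x, t)) (B i (x, t)) : ℝ)) = 0 := by
  -- The exceptional null set of `h` depends on the test field; for the fields κ(q) with q rational
  -- the union of these sets is still null. The times of κ and of `A`, `B` are decoupled.
  have hq : ∀ᵐ t ∂(volume.restrict (Ioo 0 T)), ∀ q : ℚ, (q : ℝ) ∈ Ioo 0 T →
      ∫ x in Ω, ((inner ℝ (κ (x, (q : ℝ))) (A (x, t)) : ℝ) +
        ∑ i, (inner ℝ (dx i κ (x, (q : ℝ))) (B i (x, t)) : ℝ)) = 0 := by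
    rw [ae_all_iff]
    intro q
    by_cases hqm : (q : ℝ) ∈ Ioo 0 T
    · obtain ⟨g, hg, hge⟩ := hsm q hqm
      filter_upwards [h g hg] with t ht _
      rw [← ht]
      refine setIntegral_congr_fun hΩ.measurableSet fun x hx => ?_
      have hd : ∀ i, dx i κ (x, (q : ℝ)) = fderiv ℝ g x (e i) := fun i => by
        have : (fun y => κ (y, (q : ℝ))) =ᶠ[𝓝 x] g := by
          filter_upwards [hΩ.mem_nhds hx] with y hy using hge y hy
        simp only [dx, this.fderiv_eq]
      simp only [hge x hx, hd]
    · exact ae_of_all _ fun t ht => absurd ht hqm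
  obtain ⟨C, hC⟩ := hκ.exists_bound hb
  filter_upwards [hq, hA, ae_all_iff.2 hB, ae_restrict_mem measurableSet_Ioo] with t htq htA htB ht
  -- With t frozen in `A` and `B`, the time s enters only through κ. So Λ is continuous at t,
  -- vanishes at all rational times, and hence vanishes at s = t.
  set Λ : ℝ → ℝ := fun s => ∫ x in Ω, ((inner ℝ (κ (x, s)) (A (x, t)) : ℝ) +
        ∑ i, (inner ℝ (dx i κ (x, s)) (B i (x, t)) : ℝ)) with hΛ
  have hi1 : ∀ s ∈ Icc 0 T, IntegrableOn (fun x => (inner ℝ (κ (x, s)) (A (x, t)) : ℝ)) Ω :=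
    fun s hs => integrable_inner_of_bound
      (aestronglyMeasurable_slice_of_continuousOn hΩ hκ.continuousOn hs)
      ((ae_restrict_mem hΩ.measurableSet).mono fun x hx => (hC x hx s hs).1) htA
  have hi2 : ∀ s ∈ Icc 0 T, ∀ i,
      IntegrableOn (fun x => (inner ℝ (dx i κ (x, s)) (B i (x, t)) : ℝ)) Ω :=
    fun s hs i => integrable_inner_of_bound
      (aestronglyMeasurable_slice_of_continuousOn hΩ (hκ.continuousOn_dx i) hs)
      ((ae_restrict_mem hΩ.measurableSet).mono fun x hx => (hC x hx s hs).2 i) (htB i)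
  have hcont : ContinuousAt Λ t := by
    have h1 : ContinuousAt (fun s => (∫ x in Ω, (inner ℝ (κ (x, s)) (A (x, t)) : ℝ)) +
        ∑ i, ∫ x in Ω, (inner ℝ (dx i κ (x, s)) (B i (x, t)) : ℝ)) t := by
      refine (continuousAt_integral_inner hΩ ht hκ.continuousOn
        (fun x hx s hs => (hC x hx s hs).1) htA).add (tendsto_finsetSum _ fun i _ => ?_)
      exact continuousAt_integral_inner hΩ ht (hκ.continuousOn_dx i)
        (fun x hx s hs => (hC x hx s hs).2 i) (htB i)
    refine h1.congr ?_
    filter_upwards [Icc_mem_nhds ht.1 ht.2] with s hs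
    simp only [hΛ]
    rw [integral_add (hi1 s hs) (integrable_finsetSum _ fun i _ => hi2 s hs i),
      integral_finsetSum _ fun i _ => hi2 s hs i]
  by_contra hne
  have hev : ∀ᶠ s in 𝓝 t, Λ s ≠ 0 ∧ s ∈ Ioo 0 T :=
    (hcont.eventually_ne hne).and (isOpen_Ioo.mem_nhds ht)
  obtain ⟨U, hUsub, hUo, htU⟩ := mem_nhds_iff.1 hev
  obtain ⟨q, hqU⟩ := Rat.denseRange_cast.exists_mem_open hUo ⟨t, htU⟩
  exact (hUsub hqU).1 (htq q (hUsub hqU).2)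

/-! ### The nonlinear operator along the weak solution -/

lemma normSq_sub_le {Ω : Set R3} {f g : R3 → R3} (hf : MemLp f 2 (volume.restrict Ω))
    (hg : MemLp g 2 (volume.restrict Ω)) :
    normSq Ω (fun x => f x - g x) ≤ 2 * normSq Ω f + 2 * normSq Ω g := by
  have h1 := (memLp_two_iff_integrable_sq_norm hf.1).1 hf
  have h2 := (memLp_two_iff_integrable_sq_norm hg.1).1 hg
  have h3 := (memLp_two_iff_integrable_sq_norm (hf.sub hg).1).1 (hf.sub hg)
  simp only [normSq]
  rw [← integral_const_mul, ← integral_const_mul,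
    ← integral_add (h1.const_mul 2) (h2.const_mul 2)]
  refine integral_mono h3 ((h1.const_mul 2).add (h2.const_mul 2)) fun x => ?_
  have h4 := norm_sub_le (f x) (g x)
  have h5 : ‖f x - g x‖ ^ 2 ≤ (‖f x‖ + ‖g x‖) ^ 2 := pow_le_pow_left₀ (norm_nonneg _) h4 2
  show ‖f x - g x‖ ^ 2 ≤ 2 * ‖f x‖ ^ 2 + 2 * ‖g x‖ ^ 2
  nlinarith [sq_nonneg (‖f x‖ - ‖g x‖)]

lemma memLp_of_continuous {Ω : Set R3} (hΩ : IsOpen Ω) (hb : Bornology.IsBounded Ω) {f : R3 → R3}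
    (hf : Continuous f) : MemLp f 2 (volume.restrict Ω) := by
  have := isFiniteMeasure_restrict hb
  obtain ⟨C, hC⟩ := exists_bound_on_of_continuous hb hf
  exact MemLp.of_bound hf.aestronglyMeasurable C
    ((ae_restrict_mem hΩ.measurableSet).mono fun x hx => hC x hx)

/-- The fields π[m(t)] are compared with the single field π[u]: the Lipschitz constant belongs to
`u` alone, and m(t) is bounded in H¹ uniformly in time. -/
lemma IsAdmissible.ae_normSq_le {Ω : Set R3} (hΩ : IsOpen Ω) (hb : Bornology.IsBounded Ω)
    {π : (R3 → R3) → (R3 → R3)} (hπ : IsAdmissible Ω π) {u : R3 → R3} (hu : IsSmoothSphere Ω u)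
    {m : R3 × ℝ → R3} {G : Fin 3 → R3 × ℝ → R3}
    (hs : ∀ᵐ t ∂(volume.restrict (Ioi (0 : ℝ))),
      IsH1Sphere Ω (slice m t) (fun i => slice (G i) t))
    (hbd : ∃ C : ℝ, ∀ᵐ t ∂(volume.restrict (Ioi (0 : ℝ))),
      normSq Ω (slice m t) + ∑ i, normSq Ω (slice (G i) t) ≤ C) :
    ∃ M : ℝ, ∀ᵐ t ∂(volume.restrict (Ioi (0 : ℝ))), normSq Ω (π (slice m t)) ≤ M := by
  obtain ⟨C, hC⟩ := hbd
  obtain ⟨cπ, hcπ⟩ := hπ.lipschitz u hu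
  obtain ⟨w, hw, hwe⟩ := hπ.smooth u hu
  have huL : MemLp u 2 (volume.restrict Ω) := memLp_of_continuous hΩ hb hu.smooth.continuous
  have hduL : ∀ i, MemLp (fun x => fderiv ℝ u x (e i)) 2 (volume.restrict Ω) := fun i =>
    memLp_of_continuous hΩ hb ((hu.smooth.continuous_fderiv (by simp)).clm_apply continuous_const)
  have hπu : MemLp (π u) 2 (volume.restrict Ω) :=
    (memLp_of_continuous hΩ hb hw.continuous).ae_eq hwe.symm
  refine ⟨2 * normSq Ω (π u) + 2 * (cπ ^ 2 * (2 * (normSq Ω u +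
    ∑ i, normSq Ω (fun x => fderiv ℝ u x (e i))) + 2 * C)), ?_⟩
  filter_upwards [hs, hC] with t ht htC
  have h1 := hcπ _ _ ht
  have hπm := hπ.memLp _ _ ht
  have h2 : normSq Ω (π (slice m t)) ≤ 2 * normSq Ω (π u) +
      2 * normSq Ω (fun x => π u x - π (slice m t) x) := by
    have := normSq_sub_le hπu (g := fun x => π u x - π (slice m t) x) (hπu.sub hπm)
    simp only [sub_sub_cancel] at this
    exact this
  refine h2.trans ?_
  gcongr
  refine h1.trans (mul_le_mul_of_nonneg_left ?_ (sq_nonneg cπ))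
  have h3 := normSq_sub_le huL ht.memLp
  have h4 : ∑ i, normSq Ω (fun x => fderiv ℝ u x (e i) - slice (G i) t x) ≤
      ∑ i, (2 * normSq Ω (fun x => fderiv ℝ u x (e i)) + 2 * normSq Ω (slice (G i) t)) :=
    Finset.sum_le_sum fun i _ => normSq_sub_le (hduL i) (ht.grad_memLp i)
  rw [Finset.sum_add_distrib, ← Finset.mul_sum, ← Finset.mul_sum] at h4
  linarith

lemma memLp_cyl_of_ae_normSq_le {Ω : Set R3} {T : ℝ} {P : R3 × ℝ → R3}
    (hP : AEStronglyMeasurable P (volume.restrict (cyl Ω T))) {M : ℝ}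
    (h1 : ∀ᵐ t ∂(volume.restrict (Ioo 0 T)), MemLp (slice P t) 2 (volume.restrict Ω))
    (h2 : ∀ᵐ t ∂(volume.restrict (Ioo 0 T)), normSq Ω (slice P t) ≤ M) :
    MemLp P 2 (volume.restrict (cyl Ω T)) := by
  refine (memLp_two_iff_integrable_sq_norm hP).2 ?_
  have hm : AEStronglyMeasurable (fun p => ‖P p‖ ^ 2) (volume.restrict (cyl Ω T)) := hP.norm.pow 2
  rw [restrict_cyl] at hm ⊢
  rw [integrable_prod_iff' hm]
  refine ⟨?_, ?_⟩
  · filter_upwards [h1] with t ht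
    exact (memLp_two_iff_integrable_sq_norm ht.1).1 ht
  · refine Integrable.of_bound hm.norm.prod_swap.integral_prod_right' M ?_
    filter_upwards [h2] with t ht
    rw [Real.norm_of_nonneg (integral_nonneg fun x => norm_nonneg _)]
    simpa [normSq, slice] using ht

instance isAddHaarMeasure_volume_prod : (volume : Measure (R3 × ℝ)).IsAddHaarMeasure :=
  inferInstanceAs ((volume : Measure R3).prod (volume : Measure ℝ)).IsAddHaarMeasure

/-- A test field constant in time is admissible on (0, S) for every S, so the time integrand itself
vanishes almost everywhere. Rotating the triple products isolates `g` and its derivatives, and the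
terms ⟨∂ᵢm, g × ∂ᵢm⟩ drop out. The exceptional set of times depends on `g`. -/
lemma ae_integral_weak_form {Ω : Set R3} (hΩ : IsOpen Ω) (hb : Bornology.IsBounded Ω)
    {c α : ℝ} {π : (R3 → R3) → (R3 → R3)} {ms : R3 → R3} {Gs : Fin 3 → R3 → R3}
    {m : R3 × ℝ → R3} {G : Fin 3 → R3 × ℝ → R3} {D : R3 × ℝ → R3}
    (hm : IsWeakSolution Ω c α π ms Gs m G D) {T : ℝ} (hT : 0 < T) {P : R3 × ℝ → R3}
    (hP : MemLp P 2 (volume.restrict (cyl Ω T)))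
    (hPe : ∀ᵐ t ∂(volume.restrict (Ioo 0 T)), π (slice m t) =ᵐ[volume.restrict Ω] slice P t)
    {g : R3 → R3} (hg : ContDiff ℝ ∞ g) :
    ∀ᵐ t ∂(volume.restrict (Ioo 0 T)),
      ∫ x in Ω, ((inner ℝ (g x) (D (x, t) - α • cross (m (x, t)) (D (x, t)) +
          cross (m (x, t)) (P (x, t))) : ℝ) +
        ∑ i, (inner ℝ (fderiv ℝ g x (e i)) (-(c • cross (m (x, t)) (G i (x, t)))) : ℝ)) = 0 := by
  have hH := hm.h1_cyl T hT
  have hdg : ∀ i, Continuous fun x => fderiv ℝ g x (e i) := fun i =>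
    (hg.continuous_fderiv (by simp)).clm_apply continuous_const
  have hgc : Continuous fun p : R3 × ℝ => g p.1 := hg.continuous.comp continuous_fst
  have hdgc : ∀ i, Continuous fun p : R3 × ℝ => fderiv ℝ g p.1 (e i) := fun i =>
    (hdg i).comp continuous_fst
  have hH1 : ∀ S, IsH1Cyl Ω S (fun p => g p.1) (fun i p => fderiv ℝ g p.1 (e i)) fun _ => 0 := by
    intro S
    have hg1 : ContDiff ℝ ∞ fun p : R3 × ℝ => g p.1 := hg.comp contDiff_fst
    have hfd : ∀ (p : R3 × ℝ) d, fderiv ℝ (fun p : R3 × ℝ => g p.1) p d = fderiv ℝ g p.1 d.1 :=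
      fun p d => by
        have := ((hg.differentiable (by simp) p.1).hasFDerivAt.comp p
          (hasFDerivAt_fst (𝕜 := ℝ) (p := p))).fderiv
        rw [show (fun p : R3 × ℝ => g p.1) = g ∘ Prod.fst from rfl, this]; rfl
    refine ⟨memLp_cyl_of_continuous hΩ hb S hgc, fun i => memLp_cyl_of_continuous hΩ hb S (hdgc i),
      fun i => ?_, memLp_cyl_of_continuous hΩ hb S continuous_const, ?_⟩
    · have := isWeakDeriv_of_contDiff (isOpen_cyl hΩ S) ((e i, 0) : R3 × ℝ) hg1
      simpa only [hfd] using this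
    · have := isWeakDeriv_of_contDiff (isOpen_cyl hΩ S) ((0, 1) : R3 × ℝ) hg1
      simpa only [hfd, map_zero] using this
  obtain ⟨Cg, hCg⟩ := exists_bound_on_cyl hb (T := T) hgc.continuousOn
  choose Cd hCd using fun i => exists_bound_on_cyl hb (T := T) (hdgc i).continuousOn
  have hmem := ae_restrict_mem (μ := volume) (isOpen_cyl hΩ T).measurableSet
  have hgm : MemLp (fun p : R3 × ℝ => cross (g p.1) (m p)) 2 (volume.restrict (cyl Ω T)) :=
    MemLp.bound_cross hH.memLp hgc.aestronglyMeasurable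
      (hmem.mono fun p hp => hCg p (cyl_subset Ω T hp))
  have hgG : ∀ i, MemLp (fun p : R3 × ℝ => cross (fderiv ℝ g p.1 (e i)) (m p) +
      cross (g p.1) (G i p)) 2 (volume.restrict (cyl Ω T)) := fun i =>
    (MemLp.bound_cross hH.memLp (hdgc i).aestronglyMeasurable
      (hmem.mono fun p hp => hCd i p (cyl_subset Ω T hp))).add
      (MemLp.bound_cross (hH.grad_memLp i) hgc.aestronglyMeasurable
      (hmem.mono fun p hp => hCg p (cyl_subset Ω T hp)))
  set F₁ : R3 × ℝ → ℝ := fun p => inner ℝ (D p) (g p.1) with hF₁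
  set F₂ : R3 × ℝ → ℝ := fun p => inner ℝ (D p) (cross (g p.1) (m p)) with hF₂
  set F₃ : Fin 3 → R3 × ℝ → ℝ := fun i p =>
    inner ℝ (G i p) (cross (fderiv ℝ g p.1 (e i)) (m p) + cross (g p.1) (G i p)) with hF₃
  set F₄ : R3 × ℝ → ℝ := fun p => inner ℝ (P p) (cross (g p.1) (m p)) with hF₄
  have hF₁i : IntegrableOn F₁ (cyl Ω T) :=
    MemLp.integrable_inner_two hH.dt_memLp (memLp_cyl_of_continuous hΩ hb T hgc)
  have hF₂i : IntegrableOn F₂ (cyl Ω T) := MemLp.integrable_inner_two hH.dt_memLp hgm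
  have hF₃i : ∀ i, IntegrableOn (F₃ i) (cyl Ω T) := fun i =>
    MemLp.integrable_inner_two (hH.grad_memLp i) (hgG i)
  have hF₄i : IntegrableOn F₄ (cyl Ω T) := MemLp.integrable_inner_two hP hgm
  set f : ℝ → ℝ := fun t => (∫ x in Ω, F₁ (x, t)) -
    (α * (∫ x in Ω, F₂ (x, t)) + c * ∑ i, ∫ x in Ω, F₃ i (x, t)) + ∫ x in Ω, F₄ (x, t) with hf
  have hi₁ := integrableOn_integral_slice hF₁i
  have hi₂₃ : IntegrableOn (fun t => α * (∫ x in Ω, F₂ (x, t)) +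
      c * ∑ i, ∫ x in Ω, F₃ i (x, t)) (Ioo 0 T) :=
    ((integrableOn_integral_slice hF₂i).const_mul α).add ((integrable_finsetSum _ fun i _ =>
      integrableOn_integral_slice (hF₃i i)).const_mul c)
  have hi₄ := integrableOn_integral_slice hF₄i
  have hzero : ∀ᵐ t ∂(volume.restrict (Ioo 0 T)), f t = 0 := by
    refine ae_eq_zero_of_forall_integral_eq_zero (intervalIntegrable_of_integrableOn_Ioo
      ⟨hT.le, le_rfl⟩ ((hi₁.sub hi₂₃).add hi₄)) hT fun S hS => ?_
    have hS' : S ∈ Icc 0 T := Ioo_subset_Icc_self hS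
    have hw := hm.weak_form S hS.1 _ _ _ (hH1 S)
    have h4 : ∫ t in (0 : ℝ)..S, ip Ω (π (slice m t)) (fun x => cross (g x) (m (x, t))) =
        ∫ t in (0 : ℝ)..S, ∫ x in Ω, F₄ (x, t) := by
      refine intervalIntegral_congr_of_ae ⟨hS.1.le, hS.2⟩ ?_
      filter_upwards [hPe] with t ht
      refine integral_congr_ae ?_
      filter_upwards [ht] with x hx
      simp only [hx, hF₄, slice]
    simp only [hf]
    rw [intervalIntegral.integral_add
      ((intervalIntegrable_of_integrableOn_Ioo hS' hi₁).sub
        (intervalIntegrable_of_integrableOn_Ioo hS' hi₂₃))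
      (intervalIntegrable_of_integrableOn_Ioo hS' hi₄),
      intervalIntegral.integral_sub (intervalIntegrable_of_integrableOn_Ioo hS' hi₁)
        (intervalIntegrable_of_integrableOn_Ioo hS' hi₂₃), ← h4]
    simp only [ip, slice] at hw
    simp only [hF₁, hF₂, hF₃, ip]
    rw [hw]
    ring
  filter_upwards [hzero, ae_integrable_slice hF₁i, ae_integrable_slice hF₂i,
    ae_all_iff.2 fun i => ae_integrable_slice (hF₃i i), ae_integrable_slice hF₄i]
    with t ht h1 h2 h3 h4
  have h23 : IntegrableOn (fun x => α * F₂ (x, t) + c * ∑ i, F₃ i (x, t)) Ω :=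
    (h2.const_mul α).add ((integrable_finsetSum _ fun i _ => h3 i).const_mul c)
  rw [← ht, hf]
  simp only
  rw [← integral_const_mul, ← integral_finsetSum _ fun i _ => h3 i, ← integral_const_mul,
    ← integral_add (h2.const_mul α) ((integrable_finsetSum _ fun i _ => h3 i).const_mul c),
    ← integral_sub h1 h23, ← integral_add (f := fun x => F₁ (x, t) -
      (α * F₂ (x, t) + c * ∑ i, F₃ i (x, t))) (h1.sub h23) h4]
  refine integral_congr_ae (ae_of_all _ fun x => ?_)
  simp only [hF₁, hF₂, hF₃, hF₄, Fin.sum_univ_three, inner_add_right, inner_sub_right,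
    inner_neg_right, real_inner_smul_right, inner_cross_self_right]
  rw [inner_cross_rotate (D (x, t)), inner_cross_rotate (P (x, t)), inner_cross_rotate (G 0 (x, t)),
    inner_cross_rotate (G 1 (x, t)), inner_cross_rotate (G 2 (x, t)),
    real_inner_comm (g x) (D (x, t))]
  ring

/-! ### Fields of class `H¹` -/

lemma isH1_of_contDiff {Ω : Set R3} (hΩ : IsOpen Ω) (hb : Bornology.IsBounded Ω) {u : R3 → R3}
    (hu : ContDiff ℝ ∞ u) : IsH1 Ω u fun i x => fderiv ℝ u x (e i) :=
  ⟨memLp_of_continuous hΩ hb hu.continuous,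
    fun _ => memLp_of_continuous hΩ hb
      ((hu.continuous_fderiv (by simp)).clm_apply continuous_const),
    fun i => isWeakDeriv_of_contDiff hΩ (e i) hu⟩

lemma IsH1.sub {Ω : Set R3} (hb : Bornology.IsBounded Ω) {u w : R3 → R3}
    {G H : Fin 3 → R3 → R3} (hu : IsH1 Ω u G) (hw : IsH1 Ω w H) :
    IsH1 Ω (fun x => u x - w x) fun i x => G i x - H i x :=
  ⟨hu.memLp.sub hw.memLp, fun i => (hu.grad_memLp i).sub (hw.grad_memLp i), fun i =>
    (hu.grad_weak i).sub (hw.grad_weak i) (hu.integrableOn hb) (hw.integrableOn hb)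
      (hu.integrableOn_grad hb i) (hw.integrableOn_grad hb i)⟩

lemma isH1Cyl_of_contDiff {Ω : Set R3} (hΩ : IsOpen Ω) (hb : Bornology.IsBounded Ω) (T : ℝ)
    {u : R3 × ℝ → R3} (hu : ContDiff ℝ ∞ u) : IsH1Cyl Ω T u (fun i => dx i u) (dt u) := by
  have hd : Differentiable ℝ u := hu.differentiable (by simp)
  refine ⟨memLp_cyl_of_continuous hΩ hb T hu.continuous,
    fun i => memLp_cyl_of_continuous hΩ hb T (contDiff_dx hu i).continuous, fun i => ?_,
    memLp_cyl_of_continuous hΩ hb T (contDiff_dt hu).continuous, ?_⟩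
  · rw [show dx i u = fun p => fderiv ℝ u p (e i, 0) from funext fun p => dx_eq (hd p) i]
    exact isWeakDeriv_of_contDiff (isOpen_cyl hΩ T) _ hu
  · rw [show dt u = fun p => fderiv ℝ u p (0, 1) from funext fun p => dt_eq (hd p)]
    exact isWeakDeriv_of_contDiff (isOpen_cyl hΩ T) _ hu

lemma IsH1Cyl.sub {Ω : Set R3} (hb : Bornology.IsBounded Ω) {T : ℝ} {u w : R3 × ℝ → R3}
    {G H : Fin 3 → R3 × ℝ → R3} {D E : R3 × ℝ → R3} (hu : IsH1Cyl Ω T u G D)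
    (hw : IsH1Cyl Ω T w H E) :
    IsH1Cyl Ω T (fun p => u p - w p) (fun i p => G i p - H i p) fun p => D p - E p := by
  have := isFiniteMeasure_restrict_cyl hb T
  have hint : ∀ {f : R3 × ℝ → R3}, MemLp f 2 (volume.restrict (cyl Ω T)) →
      IntegrableOn f (cyl Ω T) := fun hf => hf.integrable (by norm_num)
  exact ⟨hu.memLp.sub hw.memLp, fun i => (hu.grad_memLp i).sub (hw.grad_memLp i), fun i =>
    (hu.grad_weak i).sub (hw.grad_weak i) (hint hu.memLp) (hint hw.memLp)
      (hint (hu.grad_memLp i)) (hint (hw.grad_memLp i)), hu.dt_memLp.sub hw.dt_memLp,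
    hu.dt_weak.sub hw.dt_weak (hint hu.memLp) (hint hw.memLp) (hint hu.dt_memLp)
      (hint hw.dt_memLp)⟩

/-! ### The effective field of the strong solution -/

lemma effField_eq {c α : ℝ} {m P : R3 × ℝ → R3} (hm : ContDiff ℝ ∞ m) (p : R3 × ℝ) :
    effField c α m P p = c • lap m p + P p - α • dt m p := by
  rw [effField, laplacian_eq_lap hm]

lemma isContC1_effField {Ω : Set R3} (hΩ : IsOpen Ω) {T c α : ℝ} {m P : R3 × ℝ → R3}
    (hm : ContDiff ℝ ∞ m) (hP : IsContC1 Ω T P) : IsContC1 Ω T (effField c α m P) := by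
  have hA : ContDiff ℝ ∞ fun p => c • lap m p - α • dt m p :=
    ((contDiff_lap hm).const_smul c).sub ((contDiff_dt hm).const_smul α)
  set A : R3 × ℝ → R3 := fun p => c • lap m p - α • dt m p with hAdef
  have heq : effField c α m P = fun p => A p + P p := by
    funext p; rw [effField_eq hm, hAdef]; simp only; abel
  rw [heq]
  have hAd : ∀ t x, DifferentiableAt ℝ (slice A t) x := fun t x =>
    (contDiff_slice hA t).differentiable (by simp) x
  refine ⟨hA.continuous.continuousOn.add hP.cont, fun t ht x hx =>
    (hAd t x).differentiableWithinAt.add (hP.diff t ht x hx), fun i => ?_⟩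
  obtain ⟨Q, hQ, hQe⟩ := hP.grad_cont i
  refine ⟨fun p => dx i A p + Q p, (contDiff_dx hA i).continuous.continuousOn.add hQ,
    fun x hx t ht => ?_⟩
  have h1 : DifferentiableAt ℝ (slice P t) x :=
    (hP.diff t ht x hx).differentiableAt (hΩ.mem_nhds hx)
  have h2 : fderiv ℝ (fun y => slice A t y + slice P t y) x =
      fderiv ℝ (slice A t) x + fderiv ℝ (slice P t) x := fderiv_fun_add (hAd t x) h1
  show dx i A (x, t) + Q (x, t) = fderiv ℝ (fun y => slice A t y + slice P t y) x (e i)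
  rw [h2, hQe x hx t ht]
  rfl

/-- At each time π[m(t)] has the continuous representative `P` and, by admissibility, a smooth one.
They agree almost everywhere on the open set `Ω`, hence at every point of it. -/
lemma exists_smooth_eq_effField {Ω : Set R3} (hΩ : IsOpen Ω) {ρ : R3 → ℝ} {c α : ℝ}
    {π : (R3 → R3) → (R3 → R3)} (hπ : IsAdmissible Ω π) {ms : R3 → R3} {T : ℝ}
    {m P : R3 × ℝ → R3} (hm : IsStrongSolution Ω ρ c α π ms T m P) {t : ℝ} (ht : t ∈ Icc 0 T) :
    ∃ g : R3 → R3, ContDiff ℝ ∞ g ∧ ∀ x ∈ Ω, effField c α m P (x, t) = g x := by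
  obtain ⟨w, hw, hwe⟩ := hπ.smooth (slice m t)
    ⟨contDiff_slice hm.smooth t, fun x hx => hm.sphere x hx t ht⟩
  have hPw : EqOn (slice P t) w Ω := by
    refine Measure.eqOn_open_of_ae_eq ((hm.pi_rep t ht).symm.trans hwe) hΩ ?_
      hw.continuous.continuousOn
    exact hm.pi_reg.continuousOn.comp (continuous_id.prodMk continuous_const).continuousOn
      fun x hx => ⟨hx, ht⟩
  refine ⟨fun x => c • lap m (x, t) + w x - α • dt m (x, t), ?_, fun x hx => ?_⟩
  · exact (((contDiff_slice (contDiff_lap hm.smooth) t).const_smul c).add hw).sub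
      ((contDiff_slice (contDiff_dt hm.smooth) t).const_smul α)
  · simp only [← hPw hx, effField_eq hm.smooth, slice]

/-! ### The growth of the Dirichlet energy of a smooth field -/

/-- The fundamental theorem of calculus for ‖Z(x, ·)‖² at each x, followed by Fubini. -/
lemma normSq_slice_eq {Ω : Set R3} (hΩ : IsOpen Ω) (hb : Bornology.IsBounded Ω) (T : ℝ)
    {Z : R3 × ℝ → R3} (hZ : ContDiff ℝ ∞ Z) :
    normSq Ω (slice Z T) = normSq Ω (slice Z 0) +
      ∫ t in (0 : ℝ)..T, ∫ x in Ω, 2 * (inner ℝ (Z (x, t)) (dt Z (x, t)) : ℝ) := by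
  have hcont : Continuous fun p : ℝ × R3 => 2 * (inner ℝ (Z (p.2, p.1)) (dt Z (p.2, p.1)) : ℝ) := by
    have h1 := hZ.continuous
    have h2 := (contDiff_dt hZ).continuous
    fun_prop
  have hint : Integrable (Function.uncurry fun (t : ℝ) (x : R3) =>
      2 * (inner ℝ (Z (x, t)) (dt Z (x, t)) : ℝ))
      ((volume.restrict (uIoc 0 T)).prod (volume.restrict Ω)) := by
    rw [Measure.prod_restrict]
    refine (hcont.continuousOn.integrableOn_compact
      ((isCompact_uIcc (a := 0) (b := T)).prod hb.isCompact_closure)).mono_set ?_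
    exact prod_mono uIoc_subset_uIcc subset_closure
  rw [intervalIntegral_integral_swap hint]
  have hftc : ∀ x, ∫ t in (0 : ℝ)..T, 2 * (inner ℝ (Z (x, t)) (dt Z (x, t)) : ℝ) =
      ‖Z (x, T)‖ ^ 2 - ‖Z (x, 0)‖ ^ 2 := fun x => by
    refine intervalIntegral.integral_eq_sub_of_hasDerivAt
      (f := fun t => ‖Z (x, t)‖ ^ 2) (fun t _ => (hasDerivAt_dt hZ x t).norm_sq) ?_
    exact (hcont.comp (continuous_id.prodMk continuous_const)).intervalIntegrable _ _
  simp only [hftc]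
  have hi : ∀ t, Integrable (fun x => ‖Z (x, t)‖ ^ 2) (volume.restrict Ω) := fun t => by
    have h := memLp_of_continuous hΩ hb (contDiff_slice hZ t).continuous
    exact (memLp_two_iff_integrable_sq_norm h.1).1 h
  rw [integral_sub (hi T) (hi 0)]
  simp only [normSq, slice]
  ring

/-! ### Pointwise algebra -/

/-- To be read with a = ∂ᵢm₁, b = ∂ᵢm₂ and k = ∂ᵢK. On the left is the divergence term of ∂ᵢm₁ × K
without its second derivatives of m₁. On the right, k × m₁ + K × a is ∂ᵢ∂ₜm₁, and the last term is
the gradient part of the weak equation tested with K. -/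
lemma gradient_identity (c : ℝ) (m₁ m₂ K k a b : R3) :
    c * ((inner ℝ (cross a K) (b - a) : ℝ) + inner ℝ (cross a k) (m₂ - m₁)) =
      -c * inner ℝ (cross k m₁ + cross K a) b + c * inner ℝ (cross (m₂ - m₁) k) (b - a) -
        inner ℝ k (-(c • cross m₂ b)) := by
  simp only [inner_eq_coord, cross_zero_apply, cross_one_apply, cross_two_apply, PiLp.sub_apply,
    PiLp.add_apply, PiLp.neg_apply, PiLp.smul_apply, smul_eq_mul]
  ring

/-- To be read with L = Δm₁, d = ∂ₜm₁ and D = ∂ₜm₂. The left side is the rest of the divergence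
term, and the last term on the right is the part of the weak equation without gradients. Eliminating
d and P₁ leaves a polynomial identity. -/
lemma energy_identity (c α : ℝ) (m₁ m₂ K L P₁ P₂ d D : R3) (hd : d = cross K m₁)
    (hK : K = c • L + P₁ - α • d) :
    c * (inner ℝ (cross L K) (m₂ - m₁) : ℝ) =
      (inner ℝ D P₂ + c * inner ℝ L (D - d) - α * (‖d‖ ^ 2 + 2 * inner ℝ d (D - d))) -
      (inner ℝ (P₂ - P₁ - α • (D - d)) (cross (m₂ - m₁) K) + inner ℝ (D - d) (P₂ - P₁)) -
      inner ℝ K (D - α • cross m₂ D + cross m₂ P₂) := by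
  have hP : P₁ = K - c • L + α • d := by nth_rewrite 1 [hK]; abel
  subst hP
  subst hd
  simp only [inner_eq_coord, norm_sq_eq_coord, cross_zero_apply, cross_one_apply,
    cross_two_apply, PiLp.sub_apply, PiLp.add_apply, PiLp.smul_apply, smul_eq_mul]
  ring

/-- The integrand is c times the divergence integrand of the fields ∂ᵢm₁ × K against v, and the
normal component of these fields is ∂ₙm₁ × K = 0. The divergence theorem asks for fields smooth on
the whole space, so K is replaced by `g`, which agrees with it on `Ω`. -/
lemma integral_slice_identity {Ω : Set R3} (hb : Bornology.IsBounded Ω) {ρ : R3 → ℝ}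
    (hρ : IsDefiningFunction Ω ρ) {c α t : ℝ} {m₁ m₂ κ P₁ P₂ D₂ : R3 × ℝ → R3}
    {G₂ : Fin 3 → R3 × ℝ → R3} {g : R3 → R3} (hm₁ : ContDiff ℝ ∞ m₁)
    (hN : ∀ x ∈ frontier Ω, fderiv ℝ (slice m₁ t) x (normal ρ x) = 0)
    (hg : ContDiff ℝ ∞ g) (hκg : ∀ x ∈ Ω, κ (x, t) = g x)
    (hκ : ∀ x ∈ Ω, κ (x, t) = c • lap m₁ (x, t) + P₁ (x, t) - α • dt m₁ (x, t))
    (heq : ∀ x ∈ Ω, dt m₁ (x, t) = cross (κ (x, t)) (m₁ (x, t)))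
    (hv : IsH1 Ω (fun x => m₂ (x, t) - m₁ (x, t)) fun i x => G₂ i (x, t) - dx i m₁ (x, t)) :
    ∫ x in Ω,
      (((inner ℝ (D₂ (x, t)) (P₂ (x, t)) : ℝ) -
          α * (‖dt m₁ (x, t)‖ ^ 2 + 2 * inner ℝ (dt m₁ (x, t)) (D₂ (x, t) - dt m₁ (x, t))) -
          c * ((∑ i, (inner ℝ (dx i (dt m₁) (x, t)) (G₂ i (x, t) - dx i m₁ (x, t)) : ℝ)) -
            inner ℝ (lap m₁ (x, t)) (D₂ (x, t) - dt m₁ (x, t))) -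
          c * ∑ i, (inner ℝ (dx i m₁ (x, t)) (dx i (dt m₁) (x, t)) : ℝ)) -
        (-c * (∑ i, (inner ℝ (cross (m₂ (x, t) - m₁ (x, t)) (dx i κ (x, t)))
            (G₂ i (x, t) - dx i m₁ (x, t)) : ℝ)) +
          inner ℝ (P₂ (x, t) - P₁ (x, t) - α • (D₂ (x, t) - dt m₁ (x, t)))
            (cross (m₂ (x, t) - m₁ (x, t)) (κ (x, t))) +
          inner ℝ (D₂ (x, t) - dt m₁ (x, t)) (P₂ (x, t) - P₁ (x, t))) -
        ((inner ℝ (κ (x, t)) (D₂ (x, t) - α • cross (m₂ (x, t)) (D₂ (x, t)) +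
            cross (m₂ (x, t)) (P₂ (x, t))) : ℝ) +
          ∑ i, (inner ℝ (dx i κ (x, t)) (-(c • cross (m₂ (x, t)) (G₂ i (x, t)))) : ℝ))) = 0 := by
  have hΩ := hρ.isOpen
  have hX : ∀ i, ContDiff ℝ ∞ fun x => cross (slice (dx i m₁) t x) (g x) := fun i =>
    contDiff_cross (contDiff_slice (contDiff_dx hm₁ i) t) hg
  have hdiv := integral_divergence_eq_zero hb hρ hv hX fun x hx => by
    have h := sum_fderiv_smul_dx_eq_zero hρ hx (hN x hx)
    have h2 : ∑ i, fderiv ℝ ρ x (e i) • crossL (slice (dx i m₁) t x) (g x) =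
        crossL (∑ i, fderiv ℝ ρ x (e i) • dx i m₁ (x, t)) (g x) := by
      simp only [map_sum, map_smul, _root_.sum_apply, _root_.smul_apply, slice]
    rw [h, map_zero, _root_.zero_apply] at h2
    exact h2
  rw [← mul_zero c, ← hdiv, ← integral_const_mul]
  refine setIntegral_congr_fun hΩ.measurableSet fun x hx => ?_
  have hgd : DifferentiableAt ℝ g x := hg.differentiable (by simp) x
  have hloc : (fun y => κ (y, t)) =ᶠ[𝓝 x] g := by
    filter_upwards [hΩ.mem_nhds hx] with y hy using hκg y hy
  have hdκ : ∀ i, fderiv ℝ g x (e i) = dx i κ (x, t) := fun i => by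
    simp only [dx, hloc.fderiv_eq]
  have hXd : ∀ i, fderiv ℝ (fun x => cross (slice (dx i m₁) t x) (g x)) x (e i) =
      cross (dx i (dx i m₁) (x, t)) (κ (x, t)) + cross (dx i m₁ (x, t)) (dx i κ (x, t)) :=
    fun i => by
      rw [fderiv_cross ((contDiff_slice (contDiff_dx hm₁ i) t).differentiable (by simp) x) hgd,
        hdκ, fderiv_slice, hκg x hx]; rfl
  have hdd : ∀ i, dx i (dt m₁) (x, t) =
      cross (dx i κ (x, t)) (m₁ (x, t)) + cross (κ (x, t)) (dx i m₁ (x, t)) := fun i => by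
    have h1 : (fun y => dt m₁ (y, t)) =ᶠ[𝓝 x] fun y => cross (g y) (slice m₁ t y) := by
      filter_upwards [hΩ.mem_nhds hx] with y hy
      rw [heq y hy, hκg y hy]; rfl
    have h2 : dx i (dt m₁) (x, t) = fderiv ℝ (fun y => cross (g y) (slice m₁ t y)) x (e i) := by
      simp only [dx, h1.fderiv_eq]
    rw [h2, fderiv_cross hgd ((contDiff_slice hm₁ t).differentiable (by simp) x), hdκ,
      fderiv_slice, hκg x hx]; rfl
  have hE := energy_identity c α (m₁ (x, t)) (m₂ (x, t)) (κ (x, t)) (lap m₁ (x, t)) (P₁ (x, t))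
    (P₂ (x, t)) (dt m₁ (x, t)) (D₂ (x, t)) (heq x hx) (hκ x hx)
  have hG := fun i => gradient_identity c (m₁ (x, t)) (m₂ (x, t)) (κ (x, t)) (dx i κ (x, t))
    (dx i m₁ (x, t)) (G₂ i (x, t))
  have hL : (inner ℝ (cross (lap m₁ (x, t)) (κ (x, t))) (m₂ (x, t) - m₁ (x, t)) : ℝ) =
      ∑ i, inner ℝ (cross (dx i (dx i m₁) (x, t)) (κ (x, t))) (m₂ (x, t) - m₁ (x, t)) := by
    simp only [lap, ← crossL_apply, map_sum, _root_.sum_apply, sum_inner]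
  rw [hL, Fin.sum_univ_three] at hE
  have h0 := hG 0
  have h1 := hG 1
  have h2 := hG 2
  rw [← hdd] at h0 h1 h2
  simp only [Fin.sum_univ_three, hXd, inner_add_left]
  simp only [slice, ← hκg x hx]
  -- `gradient_identity` produces ⟨∂ᵢ∂ₜm₁, ∂ᵢm₂⟩, whereas the energy expansion contains its parts
  -- along ∂ᵢv and ∂ᵢm₁ separately.
  have hs : ∀ i, (inner ℝ (dx i (dt m₁) (x, t)) (G₂ i (x, t)) : ℝ) =
      inner ℝ (dx i (dt m₁) (x, t)) (G₂ i (x, t) - dx i m₁ (x, t)) +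
        inner ℝ (dx i m₁ (x, t)) (dx i (dt m₁) (x, t)) := fun i => by
    rw [inner_sub_right, real_inner_comm (dx i (dt m₁) (x, t)) (dx i m₁ (x, t))]; ring
  rw [hs] at h0 h1 h2
  linear_combination -hE - h0 - h1 - h2

end LLG

end

/-! ### The energy inequality for the difference -/

open LLG

theorem lemma4p2
    (Ω : Set LLG.R3) (hΩ_open : IsOpen Ω) (hΩ_conn : IsConnected Ω)
    (hΩ_bdd : Bornology.IsBounded Ω)
    (ρ : LLG.R3 → ℝ) (hρ : LLG.IsDefiningFunction Ω ρ)
    (c α : ℝ) (hc : 0 < c) (hα : 0 < α)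
    (π : (LLG.R3 → LLG.R3) → (LLG.R3 → LLG.R3)) (hπ : LLG.IsAdmissible Ω π)
    -- the common initial value, in `H¹(Ω, 𝕊²)`
    (ms : LLG.R3 → LLG.R3) (Gs : Fin 3 → LLG.R3 → LLG.R3) (hms : LLG.IsH1Sphere Ω ms Gs)
    -- the weak solution, with its weak spatial and time derivatives
    (m₂ : LLG.R3 × ℝ → LLG.R3) (G₂ : Fin 3 → LLG.R3 × ℝ → LLG.R3) (D₂ : LLG.R3 × ℝ → LLG.R3)
    (hm₂ : LLG.IsWeakSolution Ω c α π ms Gs m₂ G₂ D₂)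
    -- the strong solution, with the field `P₁ (x, t) = π[m₁(t)](x)`
    (Ts : ℝ) (hTs : 0 < Ts) (m₁ P₁ : LLG.R3 × ℝ → LLG.R3)
    (hm₁ : LLG.IsStrongSolution Ω ρ c α π ms Ts m₁ P₁)
    -- the difference, its weak derivatives, and the field `K[m₁]`
    (v : LLG.R3 × ℝ → LLG.R3) (hv : v = fun p => m₂ p - m₁ p)
    (Gv : Fin 3 → LLG.R3 × ℝ → LLG.R3) (hGv : Gv = fun i p => G₂ i p - LLG.dx i m₁ p)
    (Dv : LLG.R3 × ℝ → LLG.R3) (hDv : Dv = fun p => D₂ p - LLG.dt m₁ p)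
    (K₁ : LLG.R3 × ℝ → LLG.R3) (hK₁ : K₁ = LLG.effField c α m₁ P₁) :
    ∀ᵐ T ∂(MeasureTheory.volume.restrict (Set.Ico 0 Ts)),
      LLG.energy Ω c α Gv Dv T ≤
        - c * (∫ t in (0 : ℝ)..T, ∑ i, LLG.ip Ω
            (fun x => LLG.cross (v (x, t)) (LLG.dx i K₁ (x, t))) (LLG.slice (Gv i) t))
        + (∫ t in (0 : ℝ)..T, LLG.ip Ω
            (fun x => LLG.piShift π (LLG.slice m₁ t) (LLG.slice v t) x - α • Dv (x, t))
            (fun x => LLG.cross (v (x, t)) (K₁ (x, t))))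
        + ∫ t in (0 : ℝ)..T, LLG.ip Ω (LLG.slice Dv t)
            (LLG.piShift π (LLG.slice m₁ t) (LLG.slice v t)) := by
  subst hv hGv hDv
  have hsm := hm₁.smooth
  have hκ : IsContC1 Ω Ts K₁ := by rw [hK₁]; exact isContC1_effField hΩ_open hsm hm₁.pi_reg
  have hκg : ∀ s ∈ Ioo 0 Ts, ∃ g : R3 → R3, ContDiff ℝ ∞ g ∧ ∀ x ∈ Ω, K₁ (x, s) = g x := by
    rw [hK₁]
    exact fun s hs => exists_smooth_eq_effField hΩ_open hπ hm₁ (Ioo_subset_Icc_self hs)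
  have hκeq : ∀ p, K₁ p = c • lap m₁ p + P₁ p - α • dt m₁ p := fun p => by
    rw [hK₁, effField_eq hsm]
  have heq : ∀ x ∈ Ω, ∀ t ∈ Ioo 0 Ts, dt m₁ (x, t) = cross (K₁ (x, t)) (m₁ (x, t)) := by
    intro x hx t ht
    rw [hm₁.equation x hx t ht, ← hK₁]
    apply ext_coord <;>
      simp only [PiLp.neg_apply, cross_zero_apply, cross_one_apply, cross_two_apply] <;> ring
  clear hK₁
  have hs2 := ae_Ioo_of_ae_Ioi (T := Ts) hm₂.slice_h1
  have hH2 := hm₂.h1_cyl Ts hTs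
  have hH1 := isH1Cyl_of_contDiff hΩ_open hΩ_bdd Ts hsm
  have hHv := hH2.sub hΩ_bdd hH1
  have hsv : ∀ᵐ t ∂(volume.restrict (Ioo 0 Ts)),
      IsH1 Ω (slice (fun p => m₂ p - m₁ p) t) fun i => slice (fun p => G₂ i p - dx i m₁ p) t := by
    filter_upwards [hs2] with t ht
    exact ht.toIsH1.sub hΩ_bdd (isH1_of_contDiff hΩ_open hΩ_bdd (contDiff_slice hsm t))
  -- a representative of `π[m₂]`
  obtain ⟨P₂, hP₂m, hP₂e⟩ := hm₂.pi_meas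
  have hP₂e := ae_Ioo_of_ae_Ioi (T := Ts) hP₂e
  -- The fixed smooth field of comparison is m₁(0), which gives a bound uniform in time.
  have hP₂L : MemLp P₂ 2 (volume.restrict (cyl Ω Ts)) := by
    obtain ⟨M, hM⟩ := hπ.ae_normSq_le hΩ_open hΩ_bdd (u := slice m₁ 0)
      ⟨contDiff_slice hsm 0, fun x hx => hm₁.sphere x hx 0 ⟨le_rfl, hTs.le⟩⟩
      hm₂.slice_h1 hm₂.bounded
    refine memLp_cyl_of_ae_normSq_le
      (hP₂m.mono_set (prod_mono le_rfl Ioo_subset_Ioi_self)) (M := M) ?_ ?_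
    · filter_upwards [hs2, hP₂e] with t ht hte
      exact (hπ.memLp _ _ ht).ae_eq hte
    · filter_upwards [ae_Ioo_of_ae_Ioi hM, hP₂e] with t ht hte
      refine le_of_eq_of_le (integral_congr_ae ?_) ht
      filter_upwards [hte] with x hx
      rw [hx]
  -- bounded fields on the cylinder
  have hmem := ae_restrict_mem (μ := volume) (isOpen_cyl hΩ_open Ts).measurableSet
  have hfin := isFiniteMeasure_restrict_cyl hΩ_bdd Ts
  obtain ⟨Cκ, hCκ⟩ := hκ.exists_bound hΩ_bdd
  obtain ⟨CP, hCP⟩ := hm₁.pi_reg.exists_bound hΩ_bdd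
  have hκm := aestronglyMeasurable_cyl_of_continuousOn hΩ_open hκ.continuousOn
  have hdκm := fun i => aestronglyMeasurable_cyl_of_continuousOn hΩ_open (hκ.continuousOn_dx i)
  have hκb : ∀ᵐ p ∂(volume.restrict (cyl Ω Ts)), ‖K₁ p‖ ≤ Cκ :=
    hmem.mono fun p hp => (hCκ p.1 hp.1 p.2 (Ioo_subset_Icc_self hp.2)).1
  have hdκb : ∀ i, ∀ᵐ p ∂(volume.restrict (cyl Ω Ts)), ‖dx i K₁ p‖ ≤ Cκ := fun i =>
    hmem.mono fun p hp => (hCκ p.1 hp.1 p.2 (Ioo_subset_Icc_self hp.2)).2 i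
  have hP₁L : MemLp P₁ 2 (volume.restrict (cyl Ω Ts)) :=
    MemLp.of_bound (aestronglyMeasurable_cyl_of_continuousOn hΩ_open hm₁.pi_reg.continuousOn) CP
      (hmem.mono fun p hp => (hCP p.1 hp.1 p.2 (Ioo_subset_Icc_self hp.2)).1)
  have hsmooth : ∀ {f : R3 × ℝ → R3}, ContDiff ℝ ∞ f →
      MemLp f 2 (volume.restrict (cyl Ω Ts)) := fun hf =>
    memLp_cyl_of_continuous hΩ_open hΩ_bdd Ts hf.continuous
  -- the weak formulation with the test function `K₁`
  have hA : IntegrableOn (fun p => D₂ p - α • cross (m₂ p) (D₂ p) + cross (m₂ p) (P₂ p))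
      (cyl Ω Ts) :=
    ((hH2.dt_memLp.integrable (by norm_num)).sub
      ((MemLp.integrable_cross hH2.memLp hH2.dt_memLp).smul α)).add
      (MemLp.integrable_cross hH2.memLp hP₂L)
  have hB : ∀ i, IntegrableOn (fun p => -(c • cross (m₂ p) (G₂ i p))) (cyl Ω Ts) := fun i =>
    ((MemLp.integrable_cross hH2.memLp (hH2.grad_memLp i)).smul c).neg
  have hslice : ∀ {F : R3 × ℝ → R3}, IntegrableOn F (cyl Ω Ts) →
      ∀ᵐ t ∂(volume.restrict (Ioo 0 Ts)), IntegrableOn (slice F t) Ω := fun {F} hF => by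
    rw [IntegrableOn, restrict_cyl] at hF
    exact hF.prod_left_ae
  -- `K₁` is inserted at almost every fixed time, since it need not have a time derivative.
  have hweak := ae_integral_eq_zero_of_forall_smooth hΩ_open hΩ_bdd hκ hκg (hslice hA)
    (fun i => hslice (hB i)) fun g hg =>
      ae_integral_weak_form hΩ_open hΩ_bdd hm₂ hTs hP₂L hP₂e hg
  have hgrad := ae_integral_inner_grad_eq hΩ_bdd hρ hTs hsm hm₁.neumann hHv hsv
    (tendsto_integral_inner_initial hΩ_bdd hΩ_open hTs (contDiff_lap hsm).continuous
      hsm.continuous hm₁.initial hms.memLp (hs2.mono fun t ht => ht.memLp) hm₂.initial)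
  -- integrands
  set H₁ : R3 × ℝ → ℝ := fun p => inner ℝ (D₂ p) (P₂ p) with hH₁
  -- After integration over `Ω`: α‖∂ₜv‖² = α‖∂ₜm₂‖² - H₂, the rate of change of ⟨∇m₁, ∇v⟩ is H₃, and
  -- that of ‖∇m₁‖² / 2 is H₄. The three functions R form the right-hand side, and W is the weak
  -- equation tested with `K₁`.
  set H₂ : R3 × ℝ → ℝ := fun p =>
    α * (‖dt m₁ p‖ ^ 2 + 2 * inner ℝ (dt m₁ p) (D₂ p - dt m₁ p)) with hH₂
  set H₃ : R3 × ℝ → ℝ := fun p => (∑ i, (inner ℝ (dx i (dt m₁) p) (G₂ i p - dx i m₁ p) : ℝ)) -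
    inner ℝ (lap m₁ p) (D₂ p - dt m₁ p) with hH₃
  set H₄ : R3 × ℝ → ℝ := fun p => ∑ i, (inner ℝ (dx i m₁ p) (dx i (dt m₁) p) : ℝ) with hH₄
  set R₁ : R3 × ℝ → ℝ := fun p => ∑ i, (inner ℝ (cross (m₂ p - m₁ p) (dx i K₁ p))
    (G₂ i p - dx i m₁ p) : ℝ) with hR₁
  set R₂ : R3 × ℝ → ℝ := fun p => inner ℝ (P₂ p - P₁ p - α • (D₂ p - dt m₁ p))
    (cross (m₂ p - m₁ p) (K₁ p)) with hR₂
  set R₃ : R3 × ℝ → ℝ := fun p => inner ℝ (D₂ p - dt m₁ p) (P₂ p - P₁ p) with hR₃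
  set W : R3 × ℝ → ℝ := fun p =>
    (inner ℝ (K₁ p) (D₂ p - α • cross (m₂ p) (D₂ p) + cross (m₂ p) (P₂ p)) : ℝ) +
      ∑ i, (inner ℝ (dx i K₁ p) (-(c • cross (m₂ p) (G₂ i p))) : ℝ) with hW
  have hdt := contDiff_dt hsm
  have iH₁ : IntegrableOn H₁ (cyl Ω Ts) := MemLp.integrable_inner_two hH2.dt_memLp hP₂L
  have iH₂ : IntegrableOn H₂ (cyl Ω Ts) :=
    (((memLp_two_iff_integrable_sq_norm (hsmooth hdt).1).1 (hsmooth hdt)).add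
      ((MemLp.integrable_inner_two (hsmooth hdt) hHv.dt_memLp).const_mul 2)).const_mul α
  have iH₃ : IntegrableOn H₃ (cyl Ω Ts) :=
    (integrable_finsetSum _ fun i _ => MemLp.integrable_inner_two
      (hsmooth (contDiff_dx hdt i)) (hHv.grad_memLp i)).sub
      (MemLp.integrable_inner_two (hsmooth (contDiff_lap hsm)) hHv.dt_memLp)
  have iH₄ : IntegrableOn H₄ (cyl Ω Ts) :=
    integrable_finsetSum _ fun i _ => MemLp.integrable_inner_two (hsmooth (contDiff_dx hsm i))
      (hsmooth (contDiff_dx hdt i))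
  have iR₁ : IntegrableOn R₁ (cyl Ω Ts) :=
    integrable_finsetSum _ fun i _ => MemLp.integrable_inner_two
      (MemLp.cross_of_bound hHv.memLp (hdκm i) (hdκb i)) (hHv.grad_memLp i)
  have iR₂ : IntegrableOn R₂ (cyl Ω Ts) :=
    MemLp.integrable_inner_two ((hP₂L.sub hP₁L).sub (hHv.dt_memLp.const_smul α))
      (MemLp.cross_of_bound hHv.memLp hκm hκb)
  have iR₃ : IntegrableOn R₃ (cyl Ω Ts) :=
    MemLp.integrable_inner_two hHv.dt_memLp (hP₂L.sub hP₁L)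
  have iW : IntegrableOn W (cyl Ω Ts) :=
    (integrable_inner_of_bound hκm hκb hA).add (integrable_finsetSum _ fun i _ =>
      integrable_inner_of_bound (hdκm i) (hdκb i) (hB i))
  -- the identity at almost every time
  have hid : ∀ᵐ t ∂(volume.restrict (Ioo 0 Ts)),
      (∫ x in Ω, H₁ (x, t)) - (∫ x in Ω, H₂ (x, t)) - c * (∫ x in Ω, H₃ (x, t)) -
        c * (∫ x in Ω, H₄ (x, t)) =
      -c * (∫ x in Ω, R₁ (x, t)) + (∫ x in Ω, R₂ (x, t)) + ∫ x in Ω, R₃ (x, t) := by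
    filter_upwards [hweak, hsv, ae_integrable_slice iH₁, ae_integrable_slice iH₂,
      ae_integrable_slice iH₃, ae_integrable_slice iH₄, ae_integrable_slice iR₁,
      ae_integrable_slice iR₂, ae_integrable_slice iR₃, ae_integrable_slice iW,
      ae_restrict_mem measurableSet_Ioo] with t hwt hvt j₁ j₂ j₃ j₄ k₁ k₂ k₃ l ht
    obtain ⟨g, hg, hgκ⟩ := hκg t ht
    have key : ∫ x in Ω, ((H₁ (x, t) - H₂ (x, t) - c * H₃ (x, t) - c * H₄ (x, t)) -
        (-c * R₁ (x, t) + R₂ (x, t) + R₃ (x, t)) - W (x, t)) = 0 :=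
      integral_slice_identity hΩ_bdd hρ hsm
        (fun x hx => hm₁.neumann x hx t (Ioo_subset_Icc_self ht)) hg hgκ (fun x _ => hκeq (x, t))
        (fun x hx => heq x hx t ht) hvt
    have hL : IntegrableOn (fun x => H₁ (x, t) - H₂ (x, t) - c * H₃ (x, t) - c * H₄ (x, t)) Ω :=
      ((j₁.sub j₂).sub (j₃.const_mul c)).sub (j₄.const_mul c)
    have hR : IntegrableOn (fun x => -c * R₁ (x, t) + R₂ (x, t) + R₃ (x, t)) Ω :=
      ((k₁.const_mul (-c)).add k₂).add k₃
    have e₁ : ∫ x in Ω, (H₁ (x, t) - H₂ (x, t) - c * H₃ (x, t) - c * H₄ (x, t)) =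
        (∫ x in Ω, H₁ (x, t)) - (∫ x in Ω, H₂ (x, t)) - c * (∫ x in Ω, H₃ (x, t)) -
        c * (∫ x in Ω, H₄ (x, t)) := by
      rw [integral_sub (f := fun x => H₁ (x, t) - H₂ (x, t) - c * H₃ (x, t))
          ((j₁.sub j₂).sub (j₃.const_mul c)) (j₄.const_mul c),
        integral_sub (f := fun x => H₁ (x, t) - H₂ (x, t)) (j₁.sub j₂) (j₃.const_mul c),
        integral_sub j₁ j₂, integral_const_mul c fun x => H₃ (x, t),
        integral_const_mul c fun x => H₄ (x, t)]
    have e₂ : ∫ x in Ω, (-c * R₁ (x, t) + R₂ (x, t) + R₃ (x, t)) =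
        -c * (∫ x in Ω, R₁ (x, t)) + (∫ x in Ω, R₂ (x, t)) + ∫ x in Ω, R₃ (x, t) := by
      rw [integral_add (f := fun x => -c * R₁ (x, t) + R₂ (x, t))
          ((k₁.const_mul (-c)).add k₂) k₃,
        integral_add (k₁.const_mul (-c)) k₂, integral_const_mul (-c) fun x => R₁ (x, t)]
    rw [integral_sub (f := fun x => (H₁ (x, t) - H₂ (x, t) - c * H₃ (x, t) - c * H₄ (x, t)) -
        (-c * R₁ (x, t) + R₂ (x, t) + R₃ (x, t))) (hL.sub hR) l, integral_sub hL hR, e₁, e₂,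
      show ∫ x in Ω, W (x, t) = 0 from hwt, sub_zero] at key
    exact sub_eq_zero.1 key
  -- the integrands of the right-hand side
  have hπshift : ∀ᵐ t ∂(volume.restrict (Ioo 0 Ts)),
      piShift π (slice m₁ t) (slice (fun p => m₂ p - m₁ p) t) =ᵐ[volume.restrict Ω]
        fun x => P₂ (x, t) - P₁ (x, t) := by
    filter_upwards [hP₂e, ae_restrict_mem measurableSet_Ioo] with t hte ht
    have hfun : (fun y => slice m₁ t y + slice (fun p => m₂ p - m₁ p) t y) = slice m₂ t := by
      funext y; simp only [slice]; abel
    filter_upwards [hte, hm₁.pi_rep t (Ioo_subset_Icc_self ht)] with x hx1 hx2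
    rw [piShift, hfun, hx1, hx2]; rfl
  have hR1e : ∀ᵐ t ∂(volume.restrict (Ioo 0 Ts)),
      ∑ i, ip Ω (fun x => cross (m₂ (x, t) - m₁ (x, t)) (dx i K₁ (x, t)))
        (slice (fun p => G₂ i p - dx i m₁ p) t) = ∫ x in Ω, R₁ (x, t) := by
    filter_upwards [ae_all_iff.2 fun i => ae_integrable_slice (MemLp.integrable_inner_two
      (MemLp.cross_of_bound hHv.memLp (hdκm i) (hdκb i)) (hHv.grad_memLp i))] with t ht
    exact (integral_finsetSum _ fun i _ => ht i).symm
  have hR2e : ∀ᵐ t ∂(volume.restrict (Ioo 0 Ts)),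
      ip Ω (fun x => piShift π (slice m₁ t) (slice (fun p => m₂ p - m₁ p) t) x -
          α • (D₂ (x, t) - dt m₁ (x, t)))
        (fun x => cross (m₂ (x, t) - m₁ (x, t)) (K₁ (x, t))) = ∫ x in Ω, R₂ (x, t) := by
    filter_upwards [hπshift] with t ht
    refine integral_congr_ae ?_
    filter_upwards [ht] with x hx
    simp only [hx, hR₂]
  have hR3e : ∀ᵐ t ∂(volume.restrict (Ioo 0 Ts)),
      ip Ω (slice (fun p => D₂ p - dt m₁ p) t)
        (piShift π (slice m₁ t) (slice (fun p => m₂ p - m₁ p) t)) = ∫ x in Ω, R₃ (x, t) := by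
    filter_upwards [hπshift] with t ht
    refine integral_congr_ae ?_
    filter_upwards [ht] with x hx
    simp only [hx, hR₃, slice]
  have hH1e : ∀ᵐ t ∂(volume.restrict (Ioo 0 Ts)),
      ip Ω (slice D₂ t) (π (slice m₂ t)) = ∫ x in Ω, H₁ (x, t) := by
    filter_upwards [hP₂e] with t ht
    refine integral_congr_ae ?_
    filter_upwards [ht] with x hx
    simp only [hx, hH₁, slice]
  -- the time derivative part of the energy
  have hsq : ∀ {f : R3 × ℝ → R3}, MemLp f 2 (volume.restrict (cyl Ω Ts)) →
      IntegrableOn (fun p => ‖f p‖ ^ 2) (cyl Ω Ts) := fun hf =>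
    (memLp_two_iff_integrable_sq_norm hf.1).1 hf
  have hDe : ∀ᵐ t ∂(volume.restrict (Ioo 0 Ts)),
      α * normSq Ω (slice (fun p => D₂ p - dt m₁ p) t) =
        α * normSq Ω (slice D₂ t) - ∫ x in Ω, H₂ (x, t) := by
    filter_upwards [ae_integrable_slice (hsq hH2.dt_memLp), ae_integrable_slice iH₂] with t h1 h2
    simp only [normSq, slice]
    rw [← integral_const_mul, ← integral_const_mul, ← integral_sub (h1.const_mul α) h2]
    refine integral_congr_ae (ae_of_all _ fun x => ?_)
    simp only [hH₂, norm_sq_eq_coord, inner_eq_coord, PiLp.sub_apply]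
    ring
  have iD : IntegrableOn (fun t => α * normSq Ω (slice D₂ t)) (Ioo 0 Ts) :=
    (integrableOn_integral_slice (hsq hH2.dt_memLp)).const_mul α
  -- the gradient part of the energy
  have hGs : ∀ i, normSq Ω (Gs i) = normSq Ω (slice (dx i m₁) 0) := fun i => by
    have h := isH1_of_contDiff hΩ_open hΩ_bdd (contDiff_slice hsm 0)
    have hae := (hms.grad_weak i).ae_eq hΩ_open (h.grad_weak i) hm₁.initial.symm
      (hms.toIsH1.integrableOn_grad hΩ_bdd i) (h.integrableOn_grad hΩ_bdd i)
    refine integral_congr_ae ?_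
    filter_upwards [hae] with x hx
    rw [hx]; rfl
  rw [← Measure.restrict_congr_set Ioo_ae_eq_Ico]
  filter_upwards [hgrad, ae_Ioo_of_ae_Ioi hm₂.energy_ineq, hs2, ae_restrict_mem measurableSet_Ioo,
    ae_all_iff.2 fun i => ae_integrable_slice (integrableOn_cyl_inner hΩ_open hΩ_bdd
      (contDiff_dx hsm i).continuous (hHv.grad_memLp i))] with S hgS hES hs2S hS hiS
  have hS' : S ∈ Icc 0 Ts := Ioo_subset_Icc_self hS
  have hS'' : S ∈ Ico 0 Ts := ⟨hS.1.le, hS.2⟩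
  have hII : ∀ {f : ℝ → ℝ}, IntegrableOn f (Ioo 0 Ts) → IntervalIntegrable f volume 0 S :=
    fun hf => intervalIntegrable_of_integrableOn_Ioo hS' hf
  have hIF : ∀ {F : R3 × ℝ → ℝ}, IntegrableOn F (cyl Ω Ts) →
      IntervalIntegrable (fun t => ∫ x in Ω, F (x, t)) volume 0 S :=
    fun hF => hII (integrableOn_integral_slice hF)
  -- The square is expanded about ∇m₁, and its cross term ⟨∇m₁, ∇v⟩ is replaced by the time integral
  -- from `hgrad`.
  have hGe : ∑ i, normSq Ω (slice (fun p => G₂ i p - dx i m₁ p) S) =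
      (∑ i, normSq Ω (slice (G₂ i) S)) - (∑ i, normSq Ω (slice (dx i m₁) S)) -
        2 * ∫ t in (0 : ℝ)..S, ∫ x in Ω, H₃ (x, t) := by
    have h1 : ∀ i, normSq Ω (slice (fun p => G₂ i p - dx i m₁ p) S) =
        normSq Ω (slice (G₂ i) S) - normSq Ω (slice (dx i m₁) S) -
          2 * ∫ x in Ω, (inner ℝ (dx i m₁ (x, S)) (G₂ i (x, S) - dx i m₁ (x, S)) : ℝ) := fun i => by
      have ha := (memLp_two_iff_integrable_sq_norm (hs2S.grad_memLp i).1).1 (hs2S.grad_memLp i)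
      have hm := memLp_of_continuous hΩ_open hΩ_bdd (contDiff_slice (contDiff_dx hsm i) S).continuous
      have hb := (memLp_two_iff_integrable_sq_norm hm.1).1 hm
      rw [normSq, normSq, normSq, ← integral_const_mul, ← integral_sub ha hb,
        ← integral_sub (f := fun x => ‖slice (G₂ i) S x‖ ^ 2 - ‖slice (dx i m₁) S x‖ ^ 2)
          (ha.sub hb) ((hiS i).const_mul 2)]
      refine integral_congr_ae (ae_of_all _ fun x => ?_)
      simp only [slice, norm_sq_eq_coord, inner_eq_coord, PiLp.sub_apply]
      ring
    simp only [h1, Finset.sum_sub_distrib, ← Finset.mul_sum]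
    rw [← integral_finsetSum _ fun i _ => hiS i, hgS]
  have hm1e : ∑ i, normSq Ω (slice (dx i m₁) S) = (∑ i, normSq Ω (Gs i)) +
      2 * ∫ t in (0 : ℝ)..S, ∫ x in Ω, H₄ (x, t) := by
    have hi : ∀ i, IntegrableOn (fun p => 2 * (inner ℝ (dx i m₁ p) (dt (dx i m₁) p) : ℝ))
        (cyl Ω Ts) := fun i => (MemLp.integrable_inner_two (hsmooth (contDiff_dx hsm i))
          (hsmooth (contDiff_dt (contDiff_dx hsm i)))).const_mul 2
    simp only [hGs, normSq_slice_eq hΩ_open hΩ_bdd S (contDiff_dx hsm _), Finset.sum_add_distrib]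
    congr 1
    rw [← intervalIntegral.integral_finsetSum fun i _ => hIF (hi i),
      ← intervalIntegral.integral_const_mul]
    refine intervalIntegral_congr_of_ae hS'' ?_
    filter_upwards [ae_all_iff.2 fun i => ae_integrable_slice (hi i)] with t ht
    rw [← integral_finsetSum _ fun i _ => ht i, ← integral_const_mul]
    refine integral_congr_ae (ae_of_all _ fun x => ?_)
    simp only [hH₄, Finset.mul_sum, dx_dt_comm hsm]
  simp only [energy] at hES ⊢
  rw [intervalIntegral_congr_of_ae hS'' hDe, intervalIntegral.integral_sub (hII iD) (hIF iH₂),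
    hGe, hm1e, intervalIntegral_congr_of_ae hS'' hR1e, intervalIntegral_congr_of_ae hS'' hR2e,
    intervalIntegral_congr_of_ae hS'' hR3e]
  rw [intervalIntegral_congr_of_ae hS'' hH1e] at hES
  -- The multiples of ‖∇m*‖² from the energy inequality and from ‖∇m₁(S)‖² cancel. The energy of v
  -- is then at most the time integral of H₁ - H₂ - cH₃ - cH₄, which is exactly the right-hand side.
  have hfinal := intervalIntegral_congr_of_ae hS'' hid
  rw [intervalIntegral.integral_sub
      (((hIF iH₁).sub (hIF iH₂)).sub ((hIF iH₃).const_mul c)) ((hIF iH₄).const_mul c),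
    intervalIntegral.integral_sub ((hIF iH₁).sub (hIF iH₂)) ((hIF iH₃).const_mul c),
    intervalIntegral.integral_sub (hIF iH₁) (hIF iH₂),
    intervalIntegral.integral_add (((hIF iR₁).const_mul (-c)).add (hIF iR₂)) (hIF iR₃),
    intervalIntegral.integral_add ((hIF iR₁).const_mul (-c)) (hIF iR₂),
    intervalIntegral.integral_const_mul, intervalIntegral.integral_const_mul,
    intervalIntegral.integral_const_mul] at hfinal
  linarith
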